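/- Let $\{W(t)\}_{t\in[0,1]}$ be a family of binary memoryless symmetric channels, with input alphabet $\{\pm1\}$ and output alphabet $\overline{\mathbb R}$ (symmetric means that the output law given input $+1$ is the reflection $y\mapsto -y$ of the output law given input $-1$). Assume that the family is ordered by degradation ($W(t)$ is degraded with respect to $W(s)$ for $0\le s\le t\le 1$), that $W(0)$ is perfect (the output determines the input), that $W(1)$ is uninformative (the output is independent of the input), and that the entropy function $\mathcal H(t)=H(X_{\mathrm u}\mid Y_{\mathrm u}(t))$ is absolutely continuous on $[0,1]$, where $X_{\mathrm u}$ is uniform on $\{\pm1\}$ and $Y_{\mathrm u}(t)$ is its observation through $W(t)$. Entropies are measured in bits. Let $X=(X_0,\dots,X_{N-1})$ be a random vector with an arbitrary distribution on $\{\pm1\}^N$. Given $X$, let all observations be conditionally independent, with $Y_i(t)$, and likewise the second look $Y_i'(t)$, an observation of $X_i$ through $W(t)$; write $Y_{\sim i}(t)=(Y_l(t))_{l\ne i}$. For $i\in[N]=\{0,\dots,N-1\}$ and $j\ne i$ define $$G_i(t)=\frac{\partial}{\partial s}H\big(X\mid Y_i(s),Y_{\sim i}(t)\big)\Big|_{s=t},\qquad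 G_i^j(t)=\frac{\partial}{\partial s}H\big(X\mid Y_i(s),Y_{\sim i}(t),Y_j'(t)\big)\Big|_{s=t}.$$ These derivatives exist for almost every $t\in[0,1]$ and define integrable functions on $[0,1]$, and $$\sum_{i,j\in[N]:\,i\ne j}\int_0^1\big(G_i(t)-G_i^j(t)\big)\,dt\le N .$$ Let $\mathcal G$ be the group of permutations $\pi$ of $[N]$ such that $(X_{\pi(0)},\dots,X_{\pi(N-1)})$ has the same distribution as $X$. If $\mathcal G$ is transitive, then $G_i=G_k$ for all $i,k\in[N]$. If $\mathcal G$ is doubly transitive (for all $i\neq j$ and $k\neq l$ in $[N]$ there is $\pi\in\mathcal G$ with $\pi(i)=k$ and $\pi(j)=l$), then $G_i^j=G_k^l$ for all $i\ne j$ and $k\ne l$ in $[N]$, and $$\int_0^1\big(G_i(t)-G_i^j(t)\big)\,dt\le\frac1{N-1}\qquad\text{for all } i\neq j \text{ in } [N].$$ -/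

import Mathlib

/-- A binary-input symmetric channel with input alphabet `{±1}` (the type `ℤˣ`) and output
alphabet the extended reals: `law x` is the distribution of the output when the input is `x`,
and the law given `+1` is the reflection of the law given `-1`. -/
structure BMSChannel where
  law : ℤˣ → MeasureTheory.Measure EReal
  isProb : ∀ x, MeasureTheory.IsProbabilityMeasure (law x)
  symm : law 1 = (law (-1)).map (fun y => -y)

namespace BMSChannel

/-- The output determines the input: a measurable decoder recovers the input almost surely. -/
def IsPerfect (W : BMSChannel) : Prop :=
  ∃ φ : EReal → ℤˣ, Measurable φ ∧ ∀ x, ∀ᵐ y ∂(W.law x), φ y = x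

/-- The output is independent of the input. -/
def IsUninformative (W : BMSChannel) : Prop :=
  W.law 1 = W.law (-1)

/-- `V` is (stochastically) degraded with respect to `W`: the output of `V` is obtained by
passing the output of `W` through a third channel, which does not depend on the input. -/
def IsDegradedOf (V W : BMSChannel) : Prop :=
  ∃ K : ProbabilityTheory.Kernel EReal EReal, ProbabilityTheory.IsMarkovKernel K ∧
    ∀ x, V.law x = (W.law x).bind K

end BMSChannel

section Entropy

variable {A Y : Type*} [Fintype A] [MeasurableSpace Y]

/-- The law of an observation `Y` when the input has distribution `p` and, given the input `a`,
`Y` has law `κ a`. -/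
noncomputable def outputLaw (p : PMF A) (κ : A → MeasureTheory.Measure Y) :
    MeasureTheory.Measure Y :=
  ∑ a, p a • κ a

/-- The posterior probability `P(X = a | Y = y)`: the density of the measure
`B ↦ P(X = a, Y ∈ B)` with respect to the law of `Y`. -/
noncomputable def posteriorProb (p : PMF A) (κ : A → MeasureTheory.Measure Y) (a : A) (y : Y) : ℝ :=
  ((p a • κ a).rnDeriv (outputLaw p κ) y).toReal

/-- The conditional entropy `H(X | Y)` in bits, where `X` has distribution `p` and, given
`X = a`, `Y` has law `κ a`. -/
noncomputable def condEntropy (p : PMF A) (κ : A → MeasureTheory.Measure Y) : ℝ :=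
  ∫ y, ∑ a, Real.negMulLog (posteriorProb p κ a y) / Real.log 2 ∂(outputLaw p κ)

end Entropy

/-- The entropy function `H(X_u | Y_u(t))` of a channel family, for a uniform input bit. -/
noncomputable def channelEntropy (W : ℝ → BMSChannel) (t : ℝ) : ℝ :=
  condEntropy (PMF.uniformOfFintype ℤˣ) (W t).law

/-- A family `W(t)`, `t ∈ [0,1]`, of BMS channels, ordered by degradation, from the perfect
channel at `t = 0` to the uninformative channel at `t = 1`, with absolutely continuous entropy
function. (The values of `W` outside `[0,1]` play no role.) -/
structure IsACDegradedFamily (W : ℝ → BMSChannel) : Prop where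
  degraded : ∀ s t : ℝ, 0 ≤ s → s ≤ t → t ≤ 1 → (W t).IsDegradedOf (W s)
  perfect : (W 0).IsPerfect
  uninformative : (W 1).IsUninformative
  absolutelyContinuous : AbsolutelyContinuousOnInterval (channelEntropy W) 0 1

section GEXIT

variable {N : ℕ} {ι : Type*} [Fintype ι] [DecidableEq ι]

/-- The conditional law, given the input vector `x`, of conditionally independent observations
indexed by `ι`: observation `k` looks at the coordinate `x (σ k)` through the channel
`W (τ k)`. -/
noncomputable def observationLaw (W : ℝ → BMSChannel) (σ : ι → Fin N) (τ : ι → ℝ)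
    (x : Fin N → ℤˣ) : MeasureTheory.Measure (ι → EReal) :=
  MeasureTheory.Measure.pi fun k => (W (τ k)).law (x (σ k))

/-- The conditional entropy of the input vector given these observations, when observation `k`
has channel parameter `s` and all the others have parameter `t`. -/
noncomputable def perturbedEntropy (p : PMF (Fin N → ℤˣ)) (W : ℝ → BMSChannel) (σ : ι → Fin N)
    (k : ι) (t s : ℝ) : ℝ :=
  condEntropy p (observationLaw W σ (Function.update (fun _ => t) k s))

/-- The observation pattern of the augmented channel: every coordinate is looked at once
(`some i` looks at `i`), and the extra observation `none` is a second look at `j`. -/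
def extraLook (j : Fin N) : Option (Fin N) → Fin N
  | none => j
  | some i => i

/-- `H(X | Y_i(s), Y_{∼i}(t))`. -/
noncomputable def entropyAt (p : PMF (Fin N → ℤˣ)) (W : ℝ → BMSChannel) (i : Fin N)
    (t s : ℝ) : ℝ :=
  perturbedEntropy p W id i t s

/-- `H(X | Y_i(s), Y_{∼i}(t), Y'_j(t))`. -/
noncomputable def entropyAtExtra (p : PMF (Fin N → ℤˣ)) (W : ℝ → BMSChannel) (i j : Fin N)
    (t s : ℝ) : ℝ :=
  perturbedEntropy p W (extraLook j) (some i) t s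

/-- The GEXIT function `G_i(t)`; the derivative in `s` is that of a function on `[0,1]`. -/
noncomputable def gexit (p : PMF (Fin N → ℤˣ)) (W : ℝ → BMSChannel) (i : Fin N) (t : ℝ) : ℝ :=
  derivWithin (entropyAt p W i t) (Set.Icc 0 1) t

/-- The augmented GEXIT function `G_i^j(t)`, with a second independent look at coordinate `j`. -/
noncomputable def gexitExtra (p : PMF (Fin N → ℤˣ)) (W : ℝ → BMSChannel) (i j : Fin N)
    (t : ℝ) : ℝ :=
  derivWithin (entropyAtExtra p W i j t) (Set.Icc 0 1) t

/-- The permutations `π` for which `(X_{π(0)}, …, X_{π(N-1)})` has the same distribution as `X`. -/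
def symmetryGroup (p : PMF (Fin N → ℤˣ)) : Set (Equiv.Perm (Fin N)) :=
  {π | p.map (fun x => x ∘ π) = p}

def HasTransitiveSymmetry (p : PMF (Fin N → ℤˣ)) : Prop :=
  ∀ i j : Fin N, ∃ π ∈ symmetryGroup p, π i = j

def HasDoublyTransitiveSymmetry (p : PMF (Fin N → ℤˣ)) : Prop :=
  ∀ i j k l : Fin N, i ≠ j → k ≠ l → ∃ π ∈ symmetryGroup p, π i = k ∧ π j = l

end GEXIT

/-!
A binary memoryless symmetric channel is, up to sufficiency, the symmetric law of a soft bit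
`d ∈ [-1, 1]`, with likelihoods `1 ± d`. Expanding the binary entropy in even powers, the
conditional entropy as a function of the parameter `s` of one observation is a constant minus
`∑ cₙ mₙ(s) wₙ`. Here the even moments `mₙ` of the soft bit decrease under degradation, and the
weights `wₙ ∈ [0, 1]`, given by moments of the extrinsic bias, increase with the parameters of the
other observations, by convexity. The channel entropy is this series with all weights equal to one.

Fubini's theorem on monotone series makes all of these series termwise differentiable at almost
every `t`, and the diagonal inherits absolute continuity from the channel entropy. Monotonicity of
the weights bounds the increment of the diagonal below by the sum of the partial increments, with
equality at `t`, so the derivatives agree and the partial derivatives integrate to an entropy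
difference (the area theorem).

A second look at `j` plays the same role as the first one. Comparing the area theorems with and
without it, and writing `h` for the channel entropy, `Y = Y(t)` and `Y' = Y'_j(t)`,
`∑_{i ≠ j} ∫ (G_i - G_i^j) = I(X; Y' | Y)|_{t=1} - I(X; Y' | Y)|_{t=0} + ∫ (2 G_j^j - G_j)`
`≤ (1 - h 1) + (h 1 - h 0) ≤ 1`.
-/

open MeasureTheory Filter Topology Set ProbabilityTheory
open scoped ENNReal

theorem absolutelyContinuousOnInterval_of_dist_le {X Y : Type*} [PseudoMetricSpace X]
    [PseudoMetricSpace Y] {f : ℝ → X} {g : ℝ → Y} {a b C : ℝ}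
    (hg : AbsolutelyContinuousOnInterval g a b)
    (hfg : ∀ x ∈ uIcc a b, ∀ y ∈ uIcc a b, x ≤ y → dist (f x) (f y) ≤ C * dist (g x) (g y)) :
    AbsolutelyContinuousOnInterval f a b := by
  have dist_le : ∀ x ∈ uIcc a b, ∀ y ∈ uIcc a b, dist (f x) (f y) ≤ C * dist (g x) (g y) := by
    intro x hx y hy
    rcases le_total x y with hxy | hyx
    · exact hfg x hx y hy hxy
    · simpa only [dist_comm] using hfg y hy x hx hyx
  have tendsto_zero := Tendsto.const_mul C hg
  rw [mul_zero] at tendsto_zero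
  refine squeeze_zero' (Eventually.of_forall fun _ => Finset.sum_nonneg fun _ _ => dist_nonneg)
    (Eventually.filter_mono inf_le_right (eventually_principal.mpr fun E hE => ?_)) tendsto_zero
  rw [Finset.mul_sum]
  exact Finset.sum_le_sum fun i hi => dist_le _ (hE.1 i hi).1 _ (hE.1 i hi).2

theorem eventually_lt_tsum {α β : Type*} {l : Filter α} {u : α → β → ℝ} {u₀ : β → ℝ} {c : ℝ}
    (nonneg : ∀ᶠ x in l, ∀ n, 0 ≤ u x n) (summable : ∀ᶠ x in l, Summable (u x))
    (tendsto : ∀ n, Tendsto (fun x => u x n) l (𝓝 (u₀ n))) (summable₀ : Summable u₀)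
    (hc : c < ∑' n, u₀ n) : ∀ᶠ x in l, c < ∑' n, u x n := by
  obtain ⟨F, hF⟩ := (summable₀.hasSum.eventually (lt_mem_nhds hc)).exists
  filter_upwards [nonneg, summable,
    (tendsto_finsetSum F fun n _ => tendsto n).eventually (lt_mem_nhds hF)] with x hnn hs hlt
  exact hlt.trans_le (hs.sum_le_tsum F fun n _ => hnn n)

/-- Pratt's lemma: if no mass escapes from a sum of two nonnegative series, none escapes from
either summand. -/
theorem tendsto_tsum_of_tendsto_tsum_add {α β : Type*} {l : Filter α} {u v : α → β → ℝ}
    {u₀ v₀ : β → ℝ} (hu : ∀ᶠ x in l, ∀ n, 0 ≤ u x n) (hv : ∀ᶠ x in l, ∀ n, 0 ≤ v x n)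
    (summable_u : ∀ᶠ x in l, Summable (u x)) (summable_v : ∀ᶠ x in l, Summable (v x))
    (tendsto_u : ∀ n, Tendsto (fun x => u x n) l (𝓝 (u₀ n)))
    (tendsto_v : ∀ n, Tendsto (fun x => v x n) l (𝓝 (v₀ n)))
    (summable_u₀ : Summable u₀) (summable_v₀ : Summable v₀)
    (tendsto_add : Tendsto (fun x => ∑' n, (u x n + v x n)) l (𝓝 (∑' n, (u₀ n + v₀ n)))) :
    Tendsto (fun x => ∑' n, u x n) l (𝓝 (∑' n, u₀ n)) := by
  refine tendsto_order.mpr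
    ⟨fun c hc => eventually_lt_tsum hu summable_u tendsto_u summable_u₀ hc, fun c hc => ?_⟩
  set δ := (c - ∑' n, u₀ n) / 2 with hδ
  have hδ_pos : 0 < δ := half_pos (sub_pos.mpr hc)
  filter_upwards [summable_u, summable_v,
    tendsto_add.eventually (gt_mem_nhds (lt_add_of_pos_right _ hδ_pos)),
    eventually_lt_tsum hv summable_v tendsto_v summable_v₀ (sub_lt_self _ hδ_pos)]
    with x hsu hsv hadd hlow
  rw [hsu.tsum_add hsv, summable_u₀.tsum_add summable_v₀] at hadd
  linarith

/-- Up to an additive constant, `H` is a series of monotone functions `f n` on `[a, b]`, and `H` is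
absolutely continuous there. Each series of increments is required to converge, but not
`∑ n, f n` itself. -/
structure IsMonotoneSeries (f : ℕ → ℝ → ℝ) (H : ℝ → ℝ) (a b : ℝ) : Prop where
  le : a ≤ b
  monotoneOn : ∀ n, MonotoneOn (f n) (Icc a b)
  hasSum_sub : ∀ x ∈ Icc a b, ∀ y ∈ Icc a b, HasSum (fun n => f n y - f n x) (H y - H x)
  absolutelyContinuous : AbsolutelyContinuousOnInterval H a b

/-- An interior point at which the series `H = ∑ n, f n` may be differentiated term by term. -/
structure IsTermwiseDifferentiableAt (f : ℕ → ℝ → ℝ) (H : ℝ → ℝ) (a b t : ℝ) : Prop where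
  mem_Ioo : t ∈ Ioo a b
  differentiableAt : DifferentiableAt ℝ H t
  differentiableAt_term : ∀ n, DifferentiableAt ℝ (f n) t
  hasSum_deriv : HasSum (fun n => deriv (f n) t) (deriv H t)

theorem IsTermwiseDifferentiableAt.eventually_mem_Icc {f : ℕ → ℝ → ℝ} {H : ℝ → ℝ} {a b t : ℝ}
    (ht : IsTermwiseDifferentiableAt f H a b t) : ∀ᶠ x in 𝓝 t, x ∈ Icc a b :=
  Icc_mem_nhds ht.mem_Ioo.1 ht.mem_Ioo.2

namespace IsMonotoneSeries

variable {f : ℕ → ℝ → ℝ} {H : ℝ → ℝ} {a b : ℝ}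

theorem term_sub_nonneg (h : IsMonotoneSeries f H a b) {x y : ℝ} (hx : x ∈ Icc a b)
    (hy : y ∈ Icc a b) (hxy : x ≤ y) (n : ℕ) : 0 ≤ f n y - f n x :=
  sub_nonneg.mpr (h.monotoneOn n hx hy hxy)

theorem sub_nonneg (h : IsMonotoneSeries f H a b) {x y : ℝ} (hx : x ∈ Icc a b)
    (hy : y ∈ Icc a b) (hxy : x ≤ y) : 0 ≤ H y - H x :=
  (h.hasSum_sub x hx y hy).nonneg (h.term_sub_nonneg hx hy hxy)

theorem absolutelyContinuous_term (h : IsMonotoneSeries f H a b) (n : ℕ) :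
    AbsolutelyContinuousOnInterval (f n) a b := by
  refine absolutelyContinuousOnInterval_of_dist_le (C := 1) h.absolutelyContinuous ?_
  rw [uIcc_of_le h.le]
  intro x hx y hy hxy
  have hterm := h.term_sub_nonneg hx hy hxy
  rw [one_mul, dist_comm, dist_comm (H x), Real.dist_eq, Real.dist_eq, abs_of_nonneg (hterm n),
    abs_of_nonneg (h.sub_nonneg hx hy hxy)]
  exact le_hasSum (h.hasSum_sub x hx y hy) n fun m _ => hterm m

theorem hasSum_slope (h : IsMonotoneSeries f H a b) {t x : ℝ} (ht : t ∈ Icc a b)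
    (hx : x ∈ Icc a b) : HasSum (fun n => slope (f n) t x) (slope H t x) := by
  simpa only [slope_def_field] using (h.hasSum_sub t ht x hx).div_const (x - t)

theorem deriv_term_nonneg (h : IsMonotoneSeries f H a b) {t : ℝ} (ht : t ∈ Ioo a b) (n : ℕ) :
    0 ≤ deriv (f n) t := by
  rw [← derivWithin_of_mem_nhds (Icc_mem_nhds ht.1 ht.2)]
  exact (h.monotoneOn n).derivWithin_nonneg

theorem sum_deriv_le (h : IsMonotoneSeries f H a b) {t : ℝ} (ht : t ∈ Ioo a b)
    (hH : DifferentiableAt ℝ H t) (hf : ∀ n, DifferentiableAt ℝ (f n) t) (F : Finset ℕ) :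
    ∑ n ∈ F, deriv (f n) t ≤ deriv H t := by
  refine le_of_tendsto_of_tendsto
    (tendsto_finsetSum F fun n _ => hasDerivAt_iff_tendsto_slope.mp (hf n).hasDerivAt)
    (hasDerivAt_iff_tendsto_slope.mp hH.hasDerivAt) ?_
  filter_upwards [nhdsWithin_le_nhds (Icc_mem_nhds ht.1 ht.2)] with x hx
  have ht' := Ioo_subset_Icc_self ht
  exact sum_le_hasSum F (fun n _ => (h.monotoneOn n).slope_nonneg ht' hx) (h.hasSum_slope ht' hx)

theorem ae_differentiableAt (h : IsMonotoneSeries f H a b) :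
    ∀ᵐ t ∂volume.restrict (Icc a b),
      t ∈ Ioo a b ∧ DifferentiableAt ℝ H t ∧ ∀ n, DifferentiableAt ℝ (f n) t := by
  rw [← restrict_Ioo_eq_restrict_Icc, ae_restrict_iff' measurableSet_Ioo]
  filter_upwards [h.absolutelyContinuous.ae_differentiableAt,
    ae_all_iff.mpr fun n => (h.absolutelyContinuous_term n).ae_differentiableAt] with t hH hf ht
  have ht' : t ∈ uIcc a b := Icc_subset_uIcc (Ioo_subset_Icc_self ht)
  exact ⟨ht, hH ht', fun n => hf n ht'⟩

/-- Fubini's theorem on term-by-term differentiation. -/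
theorem ae_isTermwiseDifferentiableAt (h : IsMonotoneSeries f H a b) :
    ∀ᵐ t ∂volume.restrict (Icc a b), IsTermwiseDifferentiableAt f H a b t := by
  have integrable_deriv {g : ℝ → ℝ} (hg : AbsolutelyContinuousOnInterval g a b) :
      Integrable (deriv g) (volume.restrict (Icc a b)) :=
    (intervalIntegrable_iff_integrableOn_Icc_of_le h.le).mp hg.intervalIntegrable_deriv
  have integral_deriv {g : ℝ → ℝ} (hg : AbsolutelyContinuousOnInterval g a b) :
      ∫ t in Icc a b, deriv g t = g b - g a := by
    rw [integral_Icc_eq_integral_Ioc, ← intervalIntegral.integral_of_le h.le,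
      hg.integral_deriv_eq_sub]
  have integrable_term n := integrable_deriv (h.absolutelyContinuous_term n)
  have tendsto_integral : Tendsto
      (fun N => ∫ t in Icc a b, ∑ n ∈ Finset.range N, deriv (f n) t) atTop
      (𝓝 (∫ t in Icc a b, deriv H t)) := by
    rw [integral_deriv h.absolutelyContinuous]
    refine (h.hasSum_sub a (left_mem_Icc.mpr h.le) b (right_mem_Icc.mpr h.le)).tendsto_sum_nat.congr
      fun N => ?_
    rw [integral_finsetSum _ fun n _ => integrable_term n]
    exact Finset.sum_congr rfl fun n _ => (integral_deriv (h.absolutelyContinuous_term n)).symm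
  have tendsto_sum : ∀ᵐ t ∂volume.restrict (Icc a b), Tendsto
      (fun N => ∑ n ∈ Finset.range N, deriv (f n) t) atTop (𝓝 (deriv H t)) := by
    refine tendsto_of_integral_tendsto_of_monotone
      (fun N => integrable_finsetSum _ fun n _ => integrable_term n)
      (integrable_deriv h.absolutelyContinuous) tendsto_integral ?_ ?_
    · filter_upwards [h.ae_differentiableAt] with t ht
      exact monotone_nat_of_le_succ fun N => by
        rw [Finset.sum_range_succ]
        exact le_add_of_nonneg_right (h.deriv_term_nonneg ht.1 N)
    · filter_upwards [h.ae_differentiableAt] with t ht N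
      exact h.sum_deriv_le ht.1 ht.2.1 ht.2.2 _
  filter_upwards [h.ae_differentiableAt, tendsto_sum] with t ht hsum
  exact ⟨ht.1, ht.2.1, ht.2.2,
    (hasSum_iff_tendsto_nat_of_nonneg (h.deriv_term_nonneg ht.1) _).mpr hsum⟩

theorem tendsto_tsum_slope_mul (h : IsMonotoneSeries f H a b) {t : ℝ}
    (ht : IsTermwiseDifferentiableAt f H a b t) {w : ℕ → ℝ} (hw : ∀ n, w n ∈ Icc (0 : ℝ) 1) :
    Tendsto (fun x => ∑' n, slope (f n) t x * w n) (𝓝[≠] t) (𝓝 (∑' n, deriv (f n) t * w n)) := by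
  have mem_Icc : ∀ᶠ x in 𝓝[≠] t, x ∈ Icc a b := nhdsWithin_le_nhds ht.eventually_mem_Icc
  have slope_nonneg : ∀ᶠ x in 𝓝[≠] t, ∀ n, 0 ≤ slope (f n) t x := mem_Icc.mono fun x hx n =>
    (h.monotoneOn n).slope_nonneg (Ioo_subset_Icc_self ht.mem_Ioo) hx
  have hasSum_slope : ∀ᶠ x in 𝓝[≠] t, HasSum (fun n => slope (f n) t x) (slope H t x) :=
    mem_Icc.mono fun x hx => h.hasSum_slope (Ioo_subset_Icc_self ht.mem_Ioo) hx
  have tendsto_slope n : Tendsto (slope (f n) t) (𝓝[≠] t) (𝓝 (deriv (f n) t)) :=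
    hasDerivAt_iff_tendsto_slope.mp (ht.differentiableAt_term n).hasDerivAt
  have deriv_nonneg := h.deriv_term_nonneg ht.mem_Ioo
  have summable_mul {q v : ℕ → ℝ} (hq : ∀ n, 0 ≤ q n) (hsum : Summable q)
      (hv : ∀ n, v n ∈ Icc (0 : ℝ) 1) : Summable fun n => q n * v n :=
    hsum.of_nonneg_of_le (fun n => mul_nonneg (hq n) (hv n).1)
      fun n => mul_le_of_le_one_right (hq n) (hv n).2
  have hw' n : 1 - w n ∈ Icc (0 : ℝ) 1 := ⟨by linarith [(hw n).2], by linarith [(hw n).1]⟩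
  refine tendsto_tsum_of_tendsto_tsum_add (v := fun x n => slope (f n) t x * (1 - w n))
    (v₀ := fun n => deriv (f n) t * (1 - w n))
    (slope_nonneg.mono fun x hx n => mul_nonneg (hx n) (hw n).1)
    (slope_nonneg.mono fun x hx n => mul_nonneg (hx n) (hw' n).1)
    (slope_nonneg.mp (hasSum_slope.mono fun x hs hx => summable_mul hx hs.summable hw))
    (slope_nonneg.mp (hasSum_slope.mono fun x hs hx => summable_mul hx hs.summable hw'))
    (fun n => (tendsto_slope n).mul_const _) (fun n => (tendsto_slope n).mul_const _)
    (summable_mul deriv_nonneg ht.hasSum_deriv.summable hw)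
    (summable_mul deriv_nonneg ht.hasSum_deriv.summable hw') ?_
  simp only [← mul_add, add_sub_cancel, mul_one, ht.hasSum_deriv.tsum_eq]
  exact (hasDerivAt_iff_tendsto_slope.mp ht.differentiableAt.hasDerivAt).congr'
    (hasSum_slope.mono fun x hx => hx.tsum_eq.symm)

end IsMonotoneSeries

theorem const_mem_Icc_const {ι : Type*} {a b t : ℝ} (ht : t ∈ Icc a b) :
    (fun _ : ι => t) ∈ Icc (fun _ => a) (fun _ => b) :=
  ⟨fun _ => ht.1, fun _ => ht.2⟩

/-- A function `Φ` of parameters indexed by `ι` whose increments along the coordinate `k` are those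
of the series `H = ∑ n, f n`, except that the `n`-th term carries a weight `w k τ n ∈ [0, 1]`.
The weights grow with the parameters `τ`. -/
structure IsWeightedSeries {ι : Type*} [DecidableEq ι] (f : ℕ → ℝ → ℝ) (H : ℝ → ℝ) (a b : ℝ)
    (Φ : (ι → ℝ) → ℝ) (w : ι → (ι → ℝ) → ℕ → ℝ) : Prop extends IsMonotoneSeries f H a b where
  hasSum_update_sub : ∀ k τ x y, HasSum (fun n => (f n y - f n x) * w k τ n)
    (Φ (Function.update τ k y) - Φ (Function.update τ k x))
  weight_mem : ∀ k τ n, w k τ n ∈ Icc (0 : ℝ) 1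
  weight_monotoneOn : ∀ k n, MonotoneOn (fun τ => w k τ n) (Icc (fun _ => a) fun _ => b)

/-- The partial derivative along `k`, at the diagonal point `(t, …, t)`, of a series with terms
`f n` and weights `w`, computed term by term. -/
noncomputable def diagonalPartial {ι : Type*} (f : ℕ → ℝ → ℝ) (w : ι → (ι → ℝ) → ℕ → ℝ) (k : ι)
    (t : ℝ) : ℝ :=
  ∑' n, deriv (f n) t * w k (fun _ => t) n

namespace IsWeightedSeries

variable {ι κ : Type*} [DecidableEq ι] [DecidableEq κ] {f : ℕ → ℝ → ℝ} {H : ℝ → ℝ} {a b : ℝ}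
  {Φ : (ι → ℝ) → ℝ} {w : ι → (ι → ℝ) → ℕ → ℝ} {Ψ : (κ → ℝ) → ℝ} {v : κ → (κ → ℝ) → ℕ → ℝ}

theorem hasDerivAt_update (h : IsWeightedSeries f H a b Φ w) {t : ℝ}
    (ht : IsTermwiseDifferentiableAt f H a b t) (k : ι) :
    HasDerivAt (fun s => Φ (Function.update (fun _ => t) k s)) (diagonalPartial f w k t) t := by
  rw [hasDerivAt_iff_tendsto_slope]
  refine (h.tendsto_tsum_slope_mul ht (h.weight_mem k fun _ => t)).congr fun x => ?_
  rw [slope_def_field, ← (h.hasSum_update_sub k (fun _ => t) t x).tsum_eq, ← tsum_div_const]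
  exact tsum_congr fun n => by rw [slope_def_field, div_mul_eq_mul_div]

theorem summable_deriv_mul (h : IsWeightedSeries f H a b Φ w) {t : ℝ}
    (ht : IsTermwiseDifferentiableAt f H a b t) (k : ι) :
    Summable fun n => deriv (f n) t * w k (fun _ => t) n :=
  ht.hasSum_deriv.summable.of_nonneg_of_le
    (fun n => mul_nonneg (h.deriv_term_nonneg ht.mem_Ioo n) (h.weight_mem k _ n).1)
    fun n => mul_le_of_le_one_right (h.deriv_term_nonneg ht.mem_Ioo n) (h.weight_mem k _ n).2

theorem diagonalPartial_nonneg (h : IsWeightedSeries f H a b Φ w) {t : ℝ}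
    (ht : IsTermwiseDifferentiableAt f H a b t) (k : ι) : 0 ≤ diagonalPartial f w k t :=
  tsum_nonneg fun n => mul_nonneg (h.deriv_term_nonneg ht.mem_Ioo n) (h.weight_mem k _ n).1

theorem diagonalPartial_le_deriv (h : IsWeightedSeries f H a b Φ w) {t : ℝ}
    (ht : IsTermwiseDifferentiableAt f H a b t) (k : ι) :
    diagonalPartial f w k t ≤ deriv H t := by
  rw [← ht.hasSum_deriv.tsum_eq]
  exact (h.summable_deriv_mul ht k).tsum_le_tsum (fun n =>
    mul_le_of_le_one_right (h.deriv_term_nonneg ht.mem_Ioo n) (h.weight_mem k _ n).2)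
    ht.hasSum_deriv.summable

theorem diagonalPartial_le_diagonalPartial (h : IsWeightedSeries f H a b Φ w)
    (h' : IsWeightedSeries f H a b Ψ v) {t : ℝ} (ht : IsTermwiseDifferentiableAt f H a b t)
    {k : ι} {l : κ} (hwv : ∀ n, w k (fun _ => t) n ≤ v l (fun _ => t) n) :
    diagonalPartial f w k t ≤ diagonalPartial f v l t :=
  (h.summable_deriv_mul ht k).tsum_le_tsum
    (fun n => mul_le_mul_of_nonneg_left (hwv n) (h.deriv_term_nonneg ht.mem_Ioo n))
    (h'.summable_deriv_mul ht l)

theorem aestronglyMeasurable_diagonalPartial (h : IsWeightedSeries f H a b Φ w) (k : ι) :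
    AEStronglyMeasurable (diagonalPartial f w k) (volume.restrict (Icc a b)) := by
  have measurable_weight n :
      AEMeasurable (fun t => w k (fun _ => t) n) (volume.restrict (Icc a b)) :=
    aemeasurable_restrict_of_monotoneOn measurableSet_Icc fun s hs t ht hst =>
      h.weight_monotoneOn k n (const_mem_Icc_const hs) (const_mem_Icc_const ht) fun _ => hst
  refine aestronglyMeasurable_of_tendsto_ae atTop (fun N => ?_)
    (h.ae_isTermwiseDifferentiableAt.mono fun t ht =>
      (h.summable_deriv_mul ht k).hasSum.tendsto_sum_nat)
  exact (Finset.aemeasurable_fun_sum _ fun n _ =>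
    (measurable_deriv (f n)).aemeasurable.mul (measurable_weight n)).aestronglyMeasurable

theorem intervalIntegrable_diagonalPartial (h : IsWeightedSeries f H a b Φ w) (k : ι) :
    IntervalIntegrable (diagonalPartial f w k) volume a b := by
  have integrable_deriv := h.absolutelyContinuous.intervalIntegrable_deriv
  rw [intervalIntegrable_iff_integrableOn_Icc_of_le h.le] at integrable_deriv ⊢
  refine integrable_deriv.mono' (h.aestronglyMeasurable_diagonalPartial k) ?_
  filter_upwards [h.ae_isTermwiseDifferentiableAt] with t ht
  rw [Real.norm_of_nonneg (h.diagonalPartial_nonneg ht k)]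
  exact h.diagonalPartial_le_deriv ht k

theorem integral_diagonalPartial_le (h : IsWeightedSeries f H a b Φ w) (k : ι) :
    ∫ t in a..b, diagonalPartial f w k t ≤ H b - H a := by
  rw [← h.absolutelyContinuous.integral_deriv_eq_sub]
  exact intervalIntegral.integral_mono_ae_restrict h.le (h.intervalIntegrable_diagonalPartial k)
    h.absolutelyContinuous.intervalIntegrable_deriv
    (h.ae_isTermwiseDifferentiableAt.mono fun t ht => h.diagonalPartial_le_deriv ht k)

theorem integral_diagonalPartial_le_integral (h : IsWeightedSeries f H a b Φ w)
    (h' : IsWeightedSeries f H a b Ψ v) {k : ι} {l : κ}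
    (hwv : ∀ t ∈ Icc a b, ∀ n, w k (fun _ => t) n ≤ v l (fun _ => t) n) :
    ∫ t in a..b, diagonalPartial f w k t ≤ ∫ t in a..b, diagonalPartial f v l t :=
  intervalIntegral.integral_mono_ae_restrict h.le (h.intervalIntegrable_diagonalPartial k)
    (h'.intervalIntegrable_diagonalPartial l) (h.ae_isTermwiseDifferentiableAt.mono fun t ht =>
      h.diagonalPartial_le_diagonalPartial h' ht (hwv t (Ioo_subset_Icc_self ht.mem_Ioo)))

theorem ae_derivWithin_eq_diagonalPartial (h : IsWeightedSeries f H a b Φ w) (k : ι) :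
    ∀ᵐ t ∂volume.restrict (Icc a b),
      derivWithin (fun s => Φ (Function.update (fun _ => t) k s)) (Icc a b) t =
        diagonalPartial f w k t :=
  h.ae_isTermwiseDifferentiableAt.mono fun t ht => by
    rw [derivWithin_of_mem_nhds (Icc_mem_nhds ht.mem_Ioo.1 ht.mem_Ioo.2),
      (h.hasDerivAt_update ht k).deriv]

theorem update_sub_nonneg (h : IsWeightedSeries f H a b Φ w) (k : ι) (τ : ι → ℝ) {x y : ℝ}
    (hx : x ∈ Icc a b) (hy : y ∈ Icc a b) (hxy : x ≤ y) :
    0 ≤ Φ (Function.update τ k y) - Φ (Function.update τ k x) :=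
  (h.hasSum_update_sub k τ x y).nonneg fun n =>
    mul_nonneg (h.term_sub_nonneg hx hy hxy n) (h.weight_mem k τ n).1

theorem update_sub_le (h : IsWeightedSeries f H a b Φ w) (k : ι) (τ : ι → ℝ) {x y : ℝ}
    (hx : x ∈ Icc a b) (hy : y ∈ Icc a b) (hxy : x ≤ y) :
    Φ (Function.update τ k y) - Φ (Function.update τ k x) ≤ H y - H x :=
  hasSum_le (fun n => mul_le_of_le_one_right (h.term_sub_nonneg hx hy hxy n) (h.weight_mem k τ n).2)
    (h.hasSum_update_sub k τ x y) (h.hasSum_sub x hx y hy)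

theorem update_sub_le_update_sub_piecewise (h : IsWeightedSeries f H a b Φ w) {t x : ℝ}
    (ht : t ∈ Icc a b) (hx : x ∈ Icc a b) (F : Finset ι) (k : ι) :
    Φ (Function.update (fun _ => t) k x) - Φ (Function.update (fun _ => t) k t) ≤
      Φ (Function.update (F.piecewise (fun _ => x) fun _ => t) k x) -
        Φ (Function.update (F.piecewise (fun _ => x) fun _ => t) k t) := by
  have base_mem := const_mem_Icc_const (ι := ι) ht
  have piecewise_mem := F.piecewise_mem_Icc_of_mem_of_mem (const_mem_Icc_const hx) base_mem
  refine hasSum_le (fun n => ?_) (h.hasSum_update_sub k _ t x) (h.hasSum_update_sub k _ t x)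
  rcases le_total t x with htx | hxt
  · refine mul_le_mul_of_nonneg_left ?_ (h.term_sub_nonneg ht hx htx n)
    exact h.weight_monotoneOn k n base_mem piecewise_mem
      (F.le_piecewise_of_le_of_le (fun _ => htx) le_rfl)
  · refine mul_le_mul_of_nonpos_left ?_ (sub_nonpos.mpr (h.monotoneOn n hx ht hxt))
    exact h.weight_monotoneOn k n piecewise_mem base_mem
      (F.piecewise_le_of_le_of_le (fun _ => hxt) le_rfl)

variable [Fintype ι]

/-- Both upwards and downwards, raising the coordinates one after the other only increases the
increment along each of them, since the weights are monotone. -/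
theorem sum_update_sub_le (h : IsWeightedSeries f H a b Φ w) {t x : ℝ} (ht : t ∈ Icc a b)
    (hx : x ∈ Icc a b) :
    ∑ k, (Φ (Function.update (fun _ => t) k x) - Φ fun _ => t) ≤ Φ (fun _ => x) - Φ fun _ => t := by
  suffices partial_sum : ∀ F : Finset ι,
      ∑ k ∈ F, (Φ (Function.update (fun _ => t) k x) - Φ fun _ => t) ≤
        Φ (F.piecewise (fun _ => x) fun _ => t) - Φ fun _ => t by
    simpa only [Finset.piecewise_univ] using partial_sum Finset.univ
  intro F
  induction F using Finset.induction_on with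
  | empty => simp
  | insert k F hk ih =>
    have hstep := h.update_sub_le_update_sub_piecewise ht hx F k
    have self_update : Function.update (F.piecewise (fun _ => x) fun _ => t) k t =
        F.piecewise (fun _ => x) fun _ => t :=
      Function.update_eq_self_iff.mpr (F.piecewise_eq_of_notMem (fun _ => x) (fun _ => t) hk).symm
    rw [self_update, Function.update_eq_self_iff.mpr rfl] at hstep
    rw [Finset.sum_insert hk, F.piecewise_insert]
    linarith

theorem diagonal_sub_mem (h : IsWeightedSeries f H a b Φ w) {x y : ℝ} (hx : x ∈ Icc a b)
    (hy : y ∈ Icc a b) (hxy : x ≤ y) :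
    Φ (fun _ => y) - Φ (fun _ => x) ∈ Icc 0 (Fintype.card ι * (H y - H x)) := by
  constructor
  · refine le_trans (Finset.sum_nonneg fun k _ => ?_) (h.sum_update_sub_le hx hy)
    simpa only [Function.update_eq_self] using h.update_sub_nonneg k (fun _ => x) hx hy hxy
  · have sum_le : ∑ k, (Φ (fun _ => y) - Φ (Function.update (fun _ => y) k x)) ≤
        ∑ _k : ι, (H y - H x) := Finset.sum_le_sum fun k _ => by
      simpa only [Function.update_eq_self] using h.update_sub_le k (fun _ => y) hx hy hxy
    have le_sum := neg_le_neg (h.sum_update_sub_le hy hx)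
    simp only [← Finset.sum_neg_distrib, neg_sub] at le_sum
    rw [Finset.sum_const, Finset.card_univ, nsmul_eq_mul] at sum_le
    exact le_sum.trans sum_le

omit [Fintype ι] in
theorem absolutelyContinuous_diagonal [Finite ι] (h : IsWeightedSeries f H a b Φ w) :
    AbsolutelyContinuousOnInterval (fun t => Φ fun _ => t) a b := by
  have := Fintype.ofFinite ι
  refine absolutelyContinuousOnInterval_of_dist_le (C := Fintype.card ι) h.absolutelyContinuous ?_
  rw [uIcc_of_le h.le]
  intro x hx y hy hxy
  have hmem := h.diagonal_sub_mem hx hy hxy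
  rw [dist_comm, dist_comm (H x), Real.dist_eq, Real.dist_eq, abs_of_nonneg hmem.1,
    abs_of_nonneg (h.sub_nonneg hx hy hxy)]
  exact hmem.2

/-- By `sum_update_sub_le` the diagonal minus the sum of the coordinate sections at `t` has a local
minimum at `t`, where therefore its derivative vanishes. -/
theorem deriv_diagonal_eq_sum (h : IsWeightedSeries f H a b Φ w) {t : ℝ}
    (ht : IsTermwiseDifferentiableAt f H a b t)
    (hΦ : DifferentiableAt ℝ (fun x => Φ fun _ => x) t) :
    deriv (fun x => Φ fun _ => x) t = ∑ k, diagonalPartial f w k t := by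
  have isLocalMin : IsLocalMin
      (fun x => Φ (fun _ => x) - ∑ k, Φ (Function.update (fun _ => t) k x)) t := by
    filter_upwards [ht.eventually_mem_Icc] with x hx
    have hle := h.sum_update_sub_le (Ioo_subset_Icc_self ht.mem_Ioo) hx
    simp only [Finset.sum_sub_distrib] at hle
    simp only [Function.update_eq_self]
    linarith
  exact sub_eq_zero.mp (isLocalMin.hasDerivAt_eq_zero
    (hΦ.hasDerivAt.sub (HasDerivAt.fun_sum fun k _ => h.hasDerivAt_update ht k)))

theorem sum_integral_diagonalPartial (h : IsWeightedSeries f H a b Φ w) :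
    ∑ k, ∫ t in a..b, diagonalPartial f w k t = Φ (fun _ => b) - Φ fun _ => a := by
  rw [← intervalIntegral.integral_finsetSum fun k _ => h.intervalIntegrable_diagonalPartial k,
    ← h.absolutelyContinuous_diagonal.integral_deriv_eq_sub]
  refine intervalIntegral.integral_congr_ae_restrict ?_
  rw [uIoc_of_le h.le]
  refine ae_restrict_of_ae_restrict_of_subset Ioc_subset_Icc_self ?_
  filter_upwards [h.ae_isTermwiseDifferentiableAt, ae_restrict_of_ae
    h.absolutelyContinuous_diagonal.ae_differentiableAt] with t ht hdiff
  exact (h.deriv_diagonal_eq_sum ht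
    (hdiff (Icc_subset_uIcc (Ioo_subset_Icc_self ht.mem_Ioo)))).symm

end IsWeightedSeries

theorem integrable_of_abs_le {α : Type*} [MeasurableSpace α] {μ : Measure α} [IsFiniteMeasure μ]
    {f : α → ℝ} (hf : Measurable f) {C : ℝ} (hC : ∀ x, |f x| ≤ C) : Integrable f μ :=
  Integrable.of_bound hf.aestronglyMeasurable C (Eventually.of_forall hC)

theorem integral_comp_of_measurePreserving {α β E : Type*} [MeasurableSpace α]
    [MeasurableSpace β] [NormedAddCommGroup E] [NormedSpace ℝ E] {μ : Measure α} {ν : Measure β}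
    {T : α → β} (hT : MeasurePreserving T μ ν) {f : β → E} (hf : AEStronglyMeasurable f ν) :
    ∫ x, f (T x) ∂μ = ∫ y, f y ∂ν := by
  rw [← hT.map_eq] at hf ⊢
  exact (integral_map hT.aemeasurable hf).symm

theorem integral_bind_kernel {α β E : Type*} [MeasurableSpace α] [MeasurableSpace β]
    [NormedAddCommGroup E] [NormedSpace ℝ E] {μ : Measure α} [SFinite μ] {K : Kernel α β}
    [IsSFiniteKernel K] {f : β → E} (hf : Integrable f (μ.bind K)) :
    ∫ z, f z ∂μ.bind K = ∫ y, ∫ z, f z ∂K y ∂μ := by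
  rw [← Measure.snd_compProd, Measure.snd] at hf ⊢
  rw [integral_map measurable_snd.aemeasurable hf.aestronglyMeasurable,
    Measure.integral_compProd (f := fun q => f q.2) (hf.comp_measurable measurable_snd)]

/-- Soft bits: the possible values of the conditional mean of a uniform `±1` input. -/
abbrev SoftBit : Type := Icc (-1 : ℝ) 1

namespace SoftBit

theorem abs_le_one (d : SoftBit) : |(d : ℝ)| ≤ 1 := abs_le.mpr d.2

theorem abs_units_mul_le_one (x : ℤˣ) (d : SoftBit) : |((x : ℤ) : ℝ) * d| ≤ 1 := by
  rcases Int.units_eq_one_or x with rfl | rfl <;> simpa using abs_le_one d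

/-- Reflection `d ↦ -d` of a soft bit, the effect of flipping the input bit. -/
def reflect (d : SoftBit) : SoftBit :=
  ⟨-d, by linarith [d.2.2], by linarith [d.2.1]⟩

theorem measurable_reflect : Measurable reflect :=
  measurable_subtype_coe.neg.subtype_mk

end SoftBit

/-- The likelihood of a soft bit given the input, relative to its law for a uniform input. -/
noncomputable def likelihood (x : ℤˣ) (d : SoftBit) : ℝ := 1 + ((x : ℤ) : ℝ) * d

theorem likelihood_nonneg (x : ℤˣ) (d : SoftBit) : 0 ≤ likelihood x d :=
  neg_le_iff_add_nonneg'.mp (abs_le.mp (SoftBit.abs_units_mul_le_one x d)).1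

theorem likelihood_le_two (x : ℤˣ) (d : SoftBit) : likelihood x d ≤ 2 := by
  rw [← one_add_one_eq_two]
  exact add_le_add_right (abs_le.mp (SoftBit.abs_units_mul_le_one x d)).2 1

theorem measurable_likelihood (x : ℤˣ) : Measurable (likelihood x) :=
  (measurable_subtype_coe.const_mul _).const_add 1

theorem likelihood_one_add_likelihood_neg_one (d : SoftBit) :
    likelihood 1 d + likelihood (-1) d = 2 := by
  simp only [likelihood, Units.val_one, Units.val_neg, Int.cast_one, Int.cast_neg]
  ring

theorem likelihood_one_sub_likelihood_neg_one (d : SoftBit) :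
    likelihood 1 d - likelihood (-1) d = 2 * d := by
  simp only [likelihood, Units.val_one, Units.val_neg, Int.cast_one, Int.cast_neg]
  ring

/-- Existence of bounded measurable slopes of supporting lines, the form of convexity needed to
integrate `f` against degraded channels. -/
def HasBoundedSubgradient (f : SoftBit → ℝ) : Prop :=
  ∃ (g : SoftBit → ℝ) (C : ℝ), Measurable g ∧ (∀ d, |g d| ≤ C) ∧
    ∀ d d₀ : SoftBit, f d₀ + g d₀ * (d - d₀) ≤ f d

theorem HasBoundedSubgradient.continuous {f : SoftBit → ℝ} (hf : HasBoundedSubgradient f) :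
    Continuous f := by
  obtain ⟨g, C, -, hC, tangent⟩ := hf
  refine (LipschitzWith.of_le_add_mul' C fun d₀ d => ?_).continuous
  have slope_le : -(g d₀ * (d - d₀)) ≤ C * |(d₀ : ℝ) - d| := by
    rw [abs_sub_comm]
    refine (neg_le_abs _).trans ?_
    rw [abs_mul]
    exact mul_le_mul_of_nonneg_right (hC d₀) (abs_nonneg _)
  rw [Subtype.dist_eq, Real.dist_eq]
  linarith [tangent d d₀]

theorem HasBoundedSubgradient.integrable {f : SoftBit → ℝ} (hf : HasBoundedSubgradient f)
    (μ : Measure SoftBit) [IsFiniteMeasure μ] : Integrable f μ :=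
  hf.continuous.integrable_of_hasCompactSupport (HasCompactSupport.of_compactSpace f)

namespace BMSChannel

instance isProbabilityMeasure_law (V : BMSChannel) (x : ℤˣ) : IsProbabilityMeasure (V.law x) :=
  V.isProb x

variable (V : BMSChannel)

/-- The output law for a uniform input. -/
noncomputable def mixture : Measure EReal := (2⁻¹ : ℝ≥0∞) • (V.law 1 + V.law (-1))

instance isProbabilityMeasure_mixture : IsProbabilityMeasure V.mixture := by
  constructor
  simp only [mixture, Measure.smul_apply, Measure.add_apply, measure_univ, smul_eq_mul]
  rw [one_add_one_eq_two, ENNReal.inv_mul_cancel (by simp) (by simp)]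

theorem two_smul_mixture : (2 : ℝ≥0∞) • V.mixture = V.law 1 + V.law (-1) := by
  rw [mixture, smul_smul, ENNReal.mul_inv_cancel (by simp) (by simp), one_smul]

/-- The conditional mean of a uniform input given the output. -/
noncomputable def softBit (y : EReal) : SoftBit :=
  projIcc (-1) 1 (by norm_num) (((V.law 1).rnDeriv V.mixture y).toReal - 1)

theorem measurable_softBit : Measurable V.softBit :=
  continuous_projIcc.measurable.comp
    ((Measure.measurable_rnDeriv _ _).ennreal_toReal.sub_const 1)

theorem law_one_le : V.law 1 ≤ (2 : ℝ≥0∞) • V.mixture := by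
  rw [two_smul_mixture]
  exact Measure.le_add_right le_rfl

theorem law_one_absolutelyContinuous : V.law 1 ≪ V.mixture :=
  (Measure.absolutelyContinuous_of_le V.law_one_le).trans Measure.smul_absolutelyContinuous

theorem rnDeriv_le_two : (V.law 1).rnDeriv V.mixture ≤ᵐ[V.mixture] fun _ => 2 := by
  refine ae_le_of_forall_setLIntegral_le_of_sigmaFinite (Measure.measurable_rnDeriv _ _)
    fun s _ _ => ?_
  rw [Measure.setLIntegral_rnDeriv V.law_one_absolutelyContinuous, setLIntegral_const]
  exact V.law_one_le s

theorem rnDeriv_ae_eq : (V.law 1).rnDeriv V.mixture =ᵐ[V.mixture]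
    fun y => ENNReal.ofReal (likelihood 1 (V.softBit y)) := by
  filter_upwards [V.rnDeriv_le_two] with y hy
  have nonneg : 0 ≤ ((V.law 1).rnDeriv V.mixture y).toReal := ENNReal.toReal_nonneg
  have le_two : ((V.law 1).rnDeriv V.mixture y).toReal ≤ 2 :=
    ENNReal.toReal_le_of_le_ofReal zero_le_two (by simpa only [ENNReal.ofReal_ofNat] using hy)
  rw [likelihood, softBit, projIcc_of_mem (by norm_num) ⟨by linarith, by linarith⟩]
  simp only [Units.val_one, Int.cast_one, one_mul, add_sub_cancel]
  rw [ENNReal.ofReal_toReal (ne_top_of_le_ne_top ENNReal.ofNat_ne_top hy)]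

theorem measurable_density (x : ℤˣ) :
    Measurable fun y => ENNReal.ofReal (likelihood x (V.softBit y)) :=
  ((measurable_likelihood x).comp V.measurable_softBit).ennreal_ofReal

theorem law_one_eq_withDensity :
    V.law 1 = V.mixture.withDensity fun y => ENNReal.ofReal (likelihood 1 (V.softBit y)) := by
  rw [← withDensity_congr_ae V.rnDeriv_ae_eq,
    Measure.withDensity_rnDeriv_eq _ _ V.law_one_absolutelyContinuous]

theorem withDensity_one_add_withDensity_neg_one :
    V.mixture.withDensity (fun y => ENNReal.ofReal (likelihood 1 (V.softBit y))) +
      V.mixture.withDensity (fun y => ENNReal.ofReal (likelihood (-1) (V.softBit y))) =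
        V.law 1 + V.law (-1) := by
  rw [← withDensity_add_left (V.measurable_density 1), ← two_smul_mixture, ← withDensity_const]
  congr 1
  ext y
  rw [Pi.add_apply, ← ENNReal.ofReal_add (likelihood_nonneg _ _) (likelihood_nonneg _ _),
    likelihood_one_add_likelihood_neg_one, ENNReal.ofReal_ofNat]

theorem law_eq_withDensity (x : ℤˣ) :
    V.law x = V.mixture.withDensity fun y => ENNReal.ofReal (likelihood x (V.softBit y)) := by
  rcases Int.units_eq_one_or x with rfl | rfl
  · exact V.law_one_eq_withDensity
  · have hadd := V.withDensity_one_add_withDensity_neg_one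
    rw [← law_one_eq_withDensity] at hadd
    ext s -
    have hadd_s := congrArg (fun μ : Measure EReal => μ s) hadd
    simp only [Measure.add_apply] at hadd_s
    exact ((ENNReal.add_right_inj (measure_ne_top _ s)).mp hadd_s).symm

/-- The law of the soft bit for a uniform input. -/
noncomputable def softLaw : Measure SoftBit := V.mixture.map V.softBit

instance isProbabilityMeasure_softLaw : IsProbabilityMeasure V.softLaw :=
  Measure.isProbabilityMeasure_map V.measurable_softBit.aemeasurable

theorem integral_softLaw {f : SoftBit → ℝ} (hf : Measurable f) :
    ∫ d, f d ∂V.softLaw = ∫ y, f (V.softBit y) ∂V.mixture :=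
  integral_map V.measurable_softBit.aemeasurable hf.aestronglyMeasurable

theorem measurable_neg_ereal : Measurable fun y : EReal => -y := continuous_neg.measurable

theorem map_neg_law (x : ℤˣ) : (V.law x).map (fun y => -y) = V.law (-x) := by
  rcases Int.units_eq_one_or x with rfl | rfl
  · rw [V.symm, Measure.map_map measurable_neg_ereal measurable_neg_ereal]
    simp
  · rw [neg_neg, V.symm]

theorem measurePreserving_neg_mixture :
    MeasurePreserving (fun y : EReal => -y) V.mixture V.mixture := by
  refine ⟨measurable_neg_ereal, ?_⟩
  rw [mixture, Measure.map_smul, Measure.map_add _ _ measurable_neg_ereal, map_neg_law,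
    map_neg_law, neg_neg, add_comm]

theorem law_neg_one_eq_withDensity_neg : V.law (-1) =
    V.mixture.withDensity fun y => ENNReal.ofReal (likelihood 1 (V.softBit (-y))) := by
  rw [← map_neg_law]
  ext s hs
  rw [Measure.map_apply measurable_neg_ereal hs, V.law_eq_withDensity 1,
    withDensity_apply _ hs, withDensity_apply _ (measurable_neg_ereal hs),
    ← V.measurePreserving_neg_mixture.setLIntegral_comp_preimage (measurable_neg_ereal hs)
      (V.measurable_density 1)]
  congr 2
  ext y
  simp only [mem_preimage, neg_neg]

theorem softBit_neg_ae_eq :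
    (fun y => V.softBit (-y)) =ᵐ[V.mixture] fun y => (V.softBit y).reflect := by
  have density_ae_eq := V.law_neg_one_eq_withDensity_neg.symm.trans (V.law_eq_withDensity (-1))
  rw [withDensity_eq_iff_of_sigmaFinite
    (f := fun y => ENNReal.ofReal (likelihood 1 (V.softBit (-y))))
    ((V.measurable_density 1).comp measurable_neg_ereal).aemeasurable
    (V.measurable_density (-1)).aemeasurable] at density_ae_eq
  filter_upwards [density_ae_eq] with y hy
  rw [ENNReal.ofReal_eq_ofReal_iff (likelihood_nonneg _ _) (likelihood_nonneg _ _)] at hy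
  simp only [likelihood, Units.val_one, Units.val_neg, Int.cast_one, Int.cast_neg] at hy
  refine Subtype.ext ?_
  simp only [SoftBit.reflect]
  linarith

theorem measurePreserving_reflect : MeasurePreserving SoftBit.reflect V.softLaw V.softLaw := by
  refine ⟨SoftBit.measurable_reflect, ?_⟩
  have reflect_comp_ae_eq : SoftBit.reflect ∘ V.softBit =ᵐ[V.mixture] V.softBit ∘ fun y => -y :=
    V.softBit_neg_ae_eq.symm
  rw [softLaw, Measure.map_map SoftBit.measurable_reflect V.measurable_softBit,
    Measure.map_congr reflect_comp_ae_eq,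
    ← Measure.map_map V.measurable_softBit measurable_neg_ereal,
    V.measurePreserving_neg_mixture.map_eq]

theorem integral_law (x : ℤˣ) (φ : EReal → ℝ) :
    ∫ y, φ y ∂V.law x = ∫ y, likelihood x (V.softBit y) * φ y ∂V.mixture := by
  rw [V.law_eq_withDensity x, integral_withDensity_eq_integral_toReal_smul
    (V.measurable_density x) (Eventually.of_forall fun _ => ENNReal.ofReal_lt_top)]
  simp only [ENNReal.toReal_ofReal (likelihood_nonneg _ _), smul_eq_mul]

theorem integral_mul_softBit {φ : EReal → ℝ} (hφ : Measurable φ) {C : ℝ} (hC : ∀ y, |φ y| ≤ C) :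
    ∫ y, φ y * V.softBit y ∂V.mixture =
      2⁻¹ * (∫ y, φ y ∂V.law 1 - ∫ y, φ y ∂V.law (-1)) := by
  have integrable_mul x : Integrable (fun y => likelihood x (V.softBit y) * φ y) V.mixture := by
    refine integrable_of_abs_le (C := 2 * C)
      (((measurable_likelihood x).comp V.measurable_softBit).mul hφ) fun y => ?_
    rw [abs_mul, abs_of_nonneg (likelihood_nonneg _ _)]
    exact mul_le_mul (likelihood_le_two _ _) (hC y) (abs_nonneg _) zero_le_two
  rw [integral_law, integral_law, ← integral_sub (integrable_mul 1) (integrable_mul (-1)),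
    ← integral_const_mul]
  refine integral_congr_ae (Eventually.of_forall fun y => ?_)
  simp only [← sub_mul, likelihood_one_sub_likelihood_neg_one]
  ring

theorem integral_softLaw_coe : ∫ d, (d : ℝ) ∂V.softLaw = 0 := by
  rw [V.integral_softLaw measurable_subtype_coe]
  simpa using V.integral_mul_softBit (φ := fun _ => 1) measurable_const fun _ => abs_one.le

theorem mixture_eq_bind {V W : BMSChannel} {K : Kernel EReal EReal}
    (hK : ∀ x, V.law x = (W.law x).bind K) : V.mixture = W.mixture.bind K := by
  rw [mixture, mixture, hK, hK]
  ext s hs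
  simp only [Measure.smul_apply, Measure.add_apply,
    Measure.bind_apply hs K.measurable.aemeasurable, lintegral_smul_measure,
    lintegral_add_measure]

theorem measurePreserving_fst_compProd (W : BMSChannel) (K : Kernel EReal EReal)
    [IsMarkovKernel K] : MeasurePreserving Prod.fst (W.mixture ⊗ₘ K) W.mixture :=
  ⟨measurable_fst, Measure.fst_compProd _ _⟩

theorem measurePreserving_snd_compProd {V W : BMSChannel} {K : Kernel EReal EReal}
    [IsMarkovKernel K] (hK : ∀ x, V.law x = (W.law x).bind K) :
    MeasurePreserving Prod.snd (W.mixture ⊗ₘ K) V.mixture :=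
  ⟨measurable_snd, (Measure.snd_compProd _ _).trans (mixture_eq_bind hK).symm⟩

theorem integrable_mul_softBit {α : Type*} [MeasurableSpace α] {μ : Measure α} [IsFiniteMeasure μ]
    {ψ : α → ℝ} (hψ : Measurable ψ) {C : ℝ} (hC : ∀ z, |ψ z| ≤ C) {d : α → SoftBit}
    (hd : Measurable d) : Integrable (fun z => ψ z * d z) μ := by
  refine integrable_of_abs_le (C := C) (hψ.mul (measurable_subtype_coe.comp hd)) fun z => ?_
  rw [abs_mul]
  exact (mul_le_of_le_one_right (abs_nonneg _) (SoftBit.abs_le_one _)).trans (hC z)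

theorem integral_compProd_mul_softBit {V W : BMSChannel} {K : Kernel EReal EReal}
    [IsMarkovKernel K] (hK : ∀ x, V.law x = (W.law x).bind K) {ψ : EReal → ℝ}
    (hψ : Measurable ψ) {C : ℝ} (hC : ∀ z, |ψ z| ≤ C) :
    ∫ q, ψ q.2 * W.softBit q.1 ∂(W.mixture ⊗ₘ K) = ∫ z, ψ z * V.softBit z ∂V.mixture := by
  have integral_law_eq x : ∫ z, ψ z ∂V.law x = ∫ y, ∫ z, ψ z ∂K y ∂W.law x := by
    have integrable : Integrable ψ (V.law x) := integrable_of_abs_le hψ hC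
    rw [hK x] at integrable ⊢
    exact integral_bind_kernel integrable
  rw [Measure.integral_compProd (f := fun q : EReal × EReal => ψ q.2 * (W.softBit q.1 : ℝ))
    (integrable_mul_softBit (hψ.comp measurable_snd) (fun q => hC q.2)
      (W.measurable_softBit.comp measurable_fst))]
  simp only [integral_mul_const]
  rw [W.integral_mul_softBit (C := C) hψ.stronglyMeasurable.integral_kernel.measurable fun y => ?_,
    V.integral_mul_softBit hψ hC, integral_law_eq, integral_law_eq]
  simpa using norm_integral_le_of_norm_le_const (μ := K y) (f := ψ) (Eventually.of_forall hC)

theorem measurePreserving_softBit_comp {α : Type*} [MeasurableSpace α] {μ : Measure α}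
    {V : BMSChannel} {T : α → EReal} (hT : MeasurePreserving T μ V.mixture) :
    MeasurePreserving (fun a => V.softBit (T a)) μ V.softLaw :=
  (V.measurable_softBit.measurePreserving V.mixture).comp hT

theorem integral_mul_softBit_sub_softBit {V W : BMSChannel} {K : Kernel EReal EReal}
    [IsMarkovKernel K] (hK : ∀ x, V.law x = (W.law x).bind K) {ψ : EReal → ℝ}
    (hψ : Measurable ψ) {C : ℝ} (hC : ∀ z, |ψ z| ≤ C) :
    ∫ q, (ψ q.2 * W.softBit q.1 - ψ q.2 * V.softBit q.2) ∂(W.mixture ⊗ₘ K) = 0 := by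
  have hψ_snd : Measurable fun q : EReal × EReal => ψ q.2 := hψ.comp measurable_snd
  have integrable_mul {d : EReal × EReal → SoftBit} (hd : Measurable d) :
      Integrable (fun q => ψ q.2 * d q) (W.mixture ⊗ₘ K) :=
    integrable_mul_softBit hψ_snd (fun q => hC q.2) hd
  refine (integral_sub (integrable_mul (W.measurable_softBit.comp measurable_fst))
    (integrable_mul (V.measurable_softBit.comp measurable_snd))).trans (sub_eq_zero.mpr ?_)
  exact (integral_compProd_mul_softBit hK hψ hC).trans
    (integral_comp_of_measurePreserving (measurePreserving_snd_compProd hK)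
      (hψ.mul (measurable_subtype_coe.comp V.measurable_softBit)).aestronglyMeasurable).symm

/-- The tangent inequality at the degraded soft bit is integrated over the joint law of both
outputs; its linear term vanishes because the degraded soft bit is the conditional mean of the
original one. -/
theorem IsDegradedOf.integral_softLaw_le {V W : BMSChannel} (h : V.IsDegradedOf W)
    {f : SoftBit → ℝ} (hf : HasBoundedSubgradient f) :
    ∫ d, f d ∂V.softLaw ≤ ∫ d, f d ∂W.softLaw := by
  obtain ⟨K, _, hK⟩ := h
  have softV := measurePreserving_softBit_comp (measurePreserving_snd_compProd hK)
  have softW := measurePreserving_softBit_comp (measurePreserving_fst_compProd W K)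
  have integrable_V : Integrable (fun q => f (V.softBit q.2)) (W.mixture ⊗ₘ K) :=
    softV.integrable_comp_of_integrable (hf.integrable _)
  have integrable_W : Integrable (fun q => f (W.softBit q.1)) (W.mixture ⊗ₘ K) :=
    softW.integrable_comp_of_integrable (hf.integrable _)
  have measurable_f (μ : Measure SoftBit) : AEStronglyMeasurable f μ :=
    hf.continuous.aestronglyMeasurable
  obtain ⟨g, C, hg, hC, tangent⟩ := hf
  have hgV : Measurable fun q : EReal × EReal => g (V.softBit q.2) :=
    (hg.comp V.measurable_softBit).comp measurable_snd
  have integrable_linear : Integrable (fun q : EReal × EReal => g (V.softBit q.2) * W.softBit q.1 -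
      g (V.softBit q.2) * V.softBit q.2) (W.mixture ⊗ₘ K) :=
    (integrable_mul_softBit hgV (fun _ => hC _) (W.measurable_softBit.comp measurable_fst)).sub
      (integrable_mul_softBit hgV (fun _ => hC _) (V.measurable_softBit.comp measurable_snd))
  calc ∫ d, f d ∂V.softLaw
      = ∫ q, f (V.softBit q.2) ∂(W.mixture ⊗ₘ K) :=
        (integral_comp_of_measurePreserving softV (measurable_f _)).symm
    _ = ∫ q, (f (V.softBit q.2) + (g (V.softBit q.2) * W.softBit q.1 -
          g (V.softBit q.2) * V.softBit q.2)) ∂(W.mixture ⊗ₘ K) := by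
        rw [integral_add integrable_V integrable_linear, integral_mul_softBit_sub_softBit hK
          (ψ := fun z => g (V.softBit z)) (hg.comp V.measurable_softBit) fun _ => hC _, add_zero]
    _ ≤ ∫ q, f (W.softBit q.1) ∂(W.mixture ⊗ₘ K) :=
        integral_mono (integrable_V.add integrable_linear) integrable_W fun q => by
          simpa only [mul_sub] using tangent (W.softBit q.1) (V.softBit q.2)
    _ = ∫ d, f d ∂W.softLaw := integral_comp_of_measurePreserving softW (measurable_f _)

end BMSChannel

section WeightEntropy

variable {A : Type*} [Fintype A] {v : A → ℝ}

theorem sum_mul_div_sum (hv : ∀ a, 0 ≤ v a) (a : A) : (∑ b, v b) * (v a / ∑ b, v b) = v a :=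
  mul_div_cancel_of_imp' fun h =>
    (Finset.sum_eq_zero_iff_of_nonneg fun b _ => hv b).mp h a (Finset.mem_univ a)

/-- The homogeneous extension of the entropy (in nats) from probability vectors to unnormalized
weights. -/
noncomputable def weightEntropy (v : A → ℝ) : ℝ :=
  ∑ a, Real.negMulLog (v a) - Real.negMulLog (∑ a, v a)

theorem sum_mul_sum_negMulLog_div (hv : ∀ a, 0 ≤ v a) :
    (∑ a, v a) * ∑ a, Real.negMulLog (v a / ∑ b, v b) = weightEntropy v := by
  have negMulLog_eq a : Real.negMulLog (v a) = v a / (∑ b, v b) * Real.negMulLog (∑ b, v b) +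
      (∑ b, v b) * Real.negMulLog (v a / ∑ b, v b) := by
    rw [← Real.negMulLog_mul, sum_mul_div_sum hv]
  rw [weightEntropy, Finset.mul_sum, Finset.sum_congr rfl fun a _ => negMulLog_eq a,
    Finset.sum_add_distrib, ← Finset.sum_mul, ← Finset.sum_div]
  rcases eq_or_ne (∑ a, v a) 0 with h | h
  · simp [h]
  · rw [div_self h, one_mul, add_sub_cancel_left]

theorem continuous_weightEntropy : Continuous (weightEntropy : (A → ℝ) → ℝ) := by
  unfold weightEntropy
  fun_prop

theorem integrable_weightEntropy {X : Type*} [MeasurableSpace X] {μ : Measure X}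
    [IsFiniteMeasure μ] {q : X → A → ℝ} (hq : Measurable q) {C : ℝ} (hq0 : ∀ x a, 0 ≤ q x a)
    (hqC : ∀ x a, q x a ≤ C) : Integrable (fun x => weightEntropy (q x)) μ := by
  have isCompact_box : IsCompact (Icc (0 : A → ℝ) fun _ => C) := isCompact_Icc
  obtain ⟨B, hB⟩ := isCompact_box.exists_bound_of_continuousOn
    continuous_weightEntropy.continuousOn
  exact integrable_of_abs_le (continuous_weightEntropy.measurable.comp hq)
    fun x => hB (q x) ⟨hq0 x, hqC x⟩

end WeightEntropy

section Density

variable {A Y : Type*} [Fintype A] [MeasurableSpace Y]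

theorem outputLaw_withDensity (p : PMF A) {ν : Measure Y} {f : A → Y → ℝ}
    (hf : ∀ a, Measurable (f a)) (hf0 : ∀ a y, 0 ≤ f a y) :
    outputLaw p (fun a => ν.withDensity fun y => ENNReal.ofReal (f a y)) =
      ν.withDensity fun y => ENNReal.ofReal (∑ a, (p a).toReal * f a y) := by
  have ofReal_sum y : ENNReal.ofReal (∑ a, (p a).toReal * f a y) =
      ∑ a, p a * ENNReal.ofReal (f a y) := by
    rw [ENNReal.ofReal_sum_of_nonneg fun a _ => mul_nonneg ENNReal.toReal_nonneg (hf0 a y)]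
    refine Finset.sum_congr rfl fun a _ => ?_
    rw [ENNReal.ofReal_mul ENNReal.toReal_nonneg, ENNReal.ofReal_toReal (p.apply_ne_top a)]
  ext s hs
  simp only [outputLaw, Measure.coe_finsetSum, Finset.sum_apply, Measure.smul_apply,
    withDensity_apply _ hs, smul_eq_mul, ofReal_sum]
  rw [lintegral_finsetSum _ fun a _ => (hf a).ennreal_ofReal.const_mul _]
  exact Finset.sum_congr rfl fun a _ => (lintegral_const_mul _ (hf a).ennreal_ofReal).symm

theorem measurable_sum_prob_mul (p : PMF A) {f : A → Y → ℝ} (hf : ∀ a, Measurable (f a)) :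
    Measurable fun y => ∑ a, (p a).toReal * f a y :=
  Finset.measurable_fun_sum _ fun a _ => (hf a).const_mul _

theorem measurable_posterior (p : PMF A) {f : A → Y → ℝ} (hf : ∀ a, Measurable (f a)) (a : A) :
    Measurable fun y => (p a).toReal * f a y / ∑ b, (p b).toReal * f b y :=
  ((hf a).const_mul _).div (measurable_sum_prob_mul p hf)

theorem smul_withDensity_eq_withDensity_posterior (p : PMF A) {ν : Measure Y} {f : A → Y → ℝ}
    (hf : ∀ a, Measurable (f a)) (hf0 : ∀ a y, 0 ≤ f a y) (a : A) :
    p a • ν.withDensity (fun y => ENNReal.ofReal (f a y)) =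
      (ν.withDensity fun y => ENNReal.ofReal (∑ b, (p b).toReal * f b y)).withDensity fun y =>
        ENNReal.ofReal ((p a).toReal * f a y / ∑ b, (p b).toReal * f b y) := by
  have weight_nonneg b y : 0 ≤ (p b).toReal * f b y :=
    mul_nonneg ENNReal.toReal_nonneg (hf0 b y)
  rw [← withDensity_mul₀ (measurable_sum_prob_mul p hf).ennreal_ofReal.aemeasurable
    (measurable_posterior p hf a).ennreal_ofReal.aemeasurable,
    ← withDensity_smul _ (hf a).ennreal_ofReal]
  congr 1
  ext y
  simp only [Pi.smul_apply, Pi.mul_apply, smul_eq_mul]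
  rw [← ENNReal.ofReal_mul (Finset.sum_nonneg fun b _ => weight_nonneg b y),
    sum_mul_div_sum fun b => weight_nonneg b y, ENNReal.ofReal_mul ENNReal.toReal_nonneg,
    ENNReal.ofReal_toReal (p.apply_ne_top a)]

theorem posteriorProb_withDensity (p : PMF A) {ν : Measure Y} [IsFiniteMeasure ν]
    {f : A → Y → ℝ} (hf : ∀ a, Measurable (f a)) (hf0 : ∀ a y, 0 ≤ f a y) (a : A) :
    posteriorProb p (fun a => ν.withDensity fun y => ENNReal.ofReal (f a y)) a
      =ᵐ[ν.withDensity fun y => ENNReal.ofReal (∑ a, (p a).toReal * f a y)]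
      fun y => (p a).toReal * f a y / ∑ b, (p b).toReal * f b y := by
  have weight_nonneg b y : 0 ≤ (p b).toReal * f b y :=
    mul_nonneg ENNReal.toReal_nonneg (hf0 b y)
  have rnDeriv_ae_eq := Measure.rnDeriv_withDensity
    (ν.withDensity fun y => ENNReal.ofReal (∑ b, (p b).toReal * f b y))
    (measurable_posterior p hf a).ennreal_ofReal
  rw [← smul_withDensity_eq_withDensity_posterior p hf hf0] at rnDeriv_ae_eq
  filter_upwards [rnDeriv_ae_eq] with y hy
  rw [posteriorProb, outputLaw_withDensity p hf hf0, hy, ENNReal.toReal_ofReal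
    (div_nonneg (weight_nonneg a y) (Finset.sum_nonneg fun b _ => weight_nonneg b y))]

theorem condEntropy_withDensity (p : PMF A) {ν : Measure Y} [IsFiniteMeasure ν]
    {f : A → Y → ℝ} (hf : ∀ a, Measurable (f a)) (hf0 : ∀ a y, 0 ≤ f a y) :
    condEntropy p (fun a => ν.withDensity fun y => ENNReal.ofReal (f a y)) =
      (∫ y, weightEntropy (fun a => (p a).toReal * f a y) ∂ν) / Real.log 2 := by
  have weight_nonneg b y : 0 ≤ (p b).toReal * f b y :=
    mul_nonneg ENNReal.toReal_nonneg (hf0 b y)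
  have integrand_ae_eq : (fun y => ∑ a, Real.negMulLog (posteriorProb p
      (fun a => ν.withDensity fun y => ENNReal.ofReal (f a y)) a y) / Real.log 2)
      =ᵐ[ν.withDensity fun y => ENNReal.ofReal (∑ a, (p a).toReal * f a y)]
      fun y => ∑ a, Real.negMulLog ((p a).toReal * f a y / ∑ b, (p b).toReal * f b y) /
        Real.log 2 := by
    filter_upwards [ae_all_iff.mpr fun a => posteriorProb_withDensity p (ν := ν) hf hf0 a] with y hy
    simp only [hy]
  rw [condEntropy, outputLaw_withDensity p hf hf0, integral_congr_ae integrand_ae_eq,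
    integral_withDensity_eq_integral_toReal_smul
      (measurable_sum_prob_mul p hf).ennreal_ofReal
      (Eventually.of_forall fun _ => ENNReal.ofReal_lt_top), ← integral_div]
  refine integral_congr_ae (Eventually.of_forall fun y => ?_)
  simp only [smul_eq_mul]
  rw [ENNReal.toReal_ofReal (Finset.sum_nonneg fun b _ => weight_nonneg b y), ← Finset.sum_div,
    ← mul_div_assoc, sum_mul_sum_negMulLog_div fun a => weight_nonneg a y]

end Density

theorem pi_withDensity {ι : Type*} [Fintype ι] {E : ι → Type*} [∀ k, MeasurableSpace (E k)]
    (ν : ∀ k, Measure (E k)) [∀ k, IsProbabilityMeasure (ν k)] {f : ∀ k, E k → ℝ≥0∞}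
    (hf : ∀ k, Measurable (f k)) [∀ k, SigmaFinite ((ν k).withDensity (f k))] :
    Measure.pi (fun k => (ν k).withDensity (f k)) =
      (Measure.pi ν).withDensity fun y => ∏ k, f k (y k) := by
  refine Measure.pi_eq fun s hs => ?_
  have indicator_prod (y : ∀ k, E k) : (univ.pi s).indicator (fun y => ∏ k, f k (y k)) y =
      ∏ k, (s k).indicator (f k) (y k) := by
    by_cases hy : y ∈ univ.pi s
    · rw [indicator_of_mem hy]
      exact Finset.prod_congr rfl fun k _ => (indicator_of_mem (hy k (mem_univ k)) _).symm
    · obtain ⟨k, hk⟩ : ∃ k, y k ∉ s k := by simpa using hy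
      rw [indicator_of_notMem hy,
        Finset.prod_eq_zero (Finset.mem_univ k) (indicator_of_notMem hk _)]
  have measurable_indicator k : Measurable ((s k).indicator (f k)) := (hf k).indicator (hs k)
  rw [withDensity_apply _ (MeasurableSet.univ_pi hs),
    ← lintegral_indicator (MeasurableSet.univ_pi hs)]
  simp only [indicator_prod]
  rw [lintegral_prod_eq_prod_lintegral_of_indepFun _ _
    (iIndepFun_pi fun k => (measurable_indicator k).aemeasurable)
    fun k => (measurable_indicator k).comp (measurable_pi_apply k)]
  refine Finset.prod_congr rfl fun k _ => ?_
  rw [(measurePreserving_eval ν k).lintegral_comp (measurable_indicator k),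
    lintegral_indicator (hs k), withDensity_apply _ (hs k)]

section Observation

variable {N : ℕ} {ι : Type*} [Fintype ι]

/-- The likelihood of the soft bits `d` of all observations given the input vector `x`. -/
noncomputable def vectorLikelihood (σ : ι → Fin N) (x : Fin N → ℤˣ) (d : ι → SoftBit) : ℝ :=
  ∏ k, likelihood (x (σ k)) (d k)

theorem vectorLikelihood_nonneg (σ : ι → Fin N) (x : Fin N → ℤˣ) (d : ι → SoftBit) :
    0 ≤ vectorLikelihood σ x d :=
  Finset.prod_nonneg fun _ _ => likelihood_nonneg _ _

theorem vectorLikelihood_le (σ : ι → Fin N) (x : Fin N → ℤˣ) (d : ι → SoftBit) :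
    vectorLikelihood σ x d ≤ 2 ^ Fintype.card ι :=
  (Finset.prod_le_prod (fun _ _ => likelihood_nonneg _ _)
    fun _ _ => likelihood_le_two _ _).trans_eq (Finset.prod_const 2)

theorem measurable_vectorLikelihood (σ : ι → Fin N) (x : Fin N → ℤˣ) :
    Measurable (vectorLikelihood σ x) :=
  Finset.measurable_fun_prod _ fun k _ => (measurable_likelihood _).comp (measurable_pi_apply k)

/-- The joint law of the soft bits of all observations, for independent uniform inputs. -/
noncomputable def softLawPi (W : ℝ → BMSChannel) (τ : ι → ℝ) : Measure (ι → SoftBit) :=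
  Measure.pi fun k => (W (τ k)).softLaw

instance isProbabilityMeasure_softLawPi (W : ℝ → BMSChannel) (τ : ι → ℝ) :
    IsProbabilityMeasure (softLawPi W τ) :=
  inferInstanceAs (IsProbabilityMeasure (Measure.pi fun k => (W (τ k)).softLaw))

theorem measurePreserving_softBit_pi (W : ℝ → BMSChannel) (τ : ι → ℝ) :
    MeasurePreserving (fun (y : ι → EReal) k => (W (τ k)).softBit (y k))
      (Measure.pi fun k => (W (τ k)).mixture) (softLawPi W τ) :=
  measurePreserving_pi _ (fun k => (W (τ k)).softLaw) fun k =>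
    (W (τ k)).measurable_softBit.measurePreserving _

theorem observationLaw_eq_withDensity (W : ℝ → BMSChannel) (σ : ι → Fin N) (τ : ι → ℝ)
    (x : Fin N → ℤˣ) :
    observationLaw W σ τ x = (Measure.pi fun k => (W (τ k)).mixture).withDensity fun y =>
      ENNReal.ofReal (vectorLikelihood σ x fun k => (W (τ k)).softBit (y k)) := by
  have _ k : SigmaFinite ((W (τ k)).mixture.withDensity
      fun y => ENNReal.ofReal (likelihood (x (σ k)) ((W (τ k)).softBit y))) := by
    rw [← BMSChannel.law_eq_withDensity]
    infer_instance
  simp only [observationLaw, BMSChannel.law_eq_withDensity]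
  rw [pi_withDensity _ fun k => (W (τ k)).measurable_density _]
  simp only [vectorLikelihood, ENNReal.ofReal_prod_of_nonneg fun _ _ => likelihood_nonneg _ _]

/-- The joint density `p(x) p(d | x)` of the input vector and the soft bits, as a weight vector
indexed by `x`. -/
noncomputable def jointWeight (p : PMF (Fin N → ℤˣ)) (σ : ι → Fin N) (d : ι → SoftBit)
    (x : Fin N → ℤˣ) : ℝ :=
  (p x).toReal * vectorLikelihood σ x d

theorem jointWeight_nonneg (p : PMF (Fin N → ℤˣ)) (σ : ι → Fin N) (d : ι → SoftBit)
    (x : Fin N → ℤˣ) : 0 ≤ jointWeight p σ d x :=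
  mul_nonneg ENNReal.toReal_nonneg (vectorLikelihood_nonneg _ _ _)

theorem jointWeight_le (p : PMF (Fin N → ℤˣ)) (σ : ι → Fin N) (d : ι → SoftBit)
    (x : Fin N → ℤˣ) : jointWeight p σ d x ≤ 2 ^ Fintype.card ι := by
  have prob_le_one : (p x).toReal ≤ 1 := by
    simpa using ENNReal.toReal_mono ENNReal.one_ne_top (p.coe_le_one x)
  exact (mul_le_of_le_one_left (vectorLikelihood_nonneg _ _ _) prob_le_one).trans
    (vectorLikelihood_le _ _ _)

theorem measurable_jointWeight (p : PMF (Fin N → ℤˣ)) (σ : ι → Fin N) :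
    Measurable (jointWeight p σ) :=
  measurable_pi_lambda _ fun x => (measurable_vectorLikelihood σ x).const_mul _

theorem measurable_weightEntropy_jointWeight (p : PMF (Fin N → ℤˣ)) (σ : ι → Fin N) :
    Measurable fun d => weightEntropy (jointWeight p σ d) :=
  continuous_weightEntropy.measurable.comp (measurable_jointWeight p σ)

theorem condEntropy_observationLaw (p : PMF (Fin N → ℤˣ)) (W : ℝ → BMSChannel) (σ : ι → Fin N)
    (τ : ι → ℝ) : condEntropy p (observationLaw W σ τ) =
      (∫ d, weightEntropy (jointWeight p σ d) ∂softLawPi W τ) / Real.log 2 := by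
  have softBits := measurePreserving_softBit_pi W τ
  rw [funext (observationLaw_eq_withDensity W σ τ), condEntropy_withDensity p
    (f := fun x (y : ι → EReal) => vectorLikelihood σ x fun k => (W (τ k)).softBit (y k))
    (fun x => (measurable_vectorLikelihood σ x).comp softBits.measurable)
    fun x y => vectorLikelihood_nonneg _ _ _,
    ← integral_comp_of_measurePreserving softBits
      (measurable_weightEntropy_jointWeight p σ).aestronglyMeasurable]
  rfl

end Observation

theorem channelEntropy_eq_integral (W : ℝ → BMSChannel) (t : ℝ) :
    channelEntropy W t =
      (∫ d, weightEntropy (fun x => 2⁻¹ * likelihood x d) ∂(W t).softLaw) / Real.log 2 := by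
  have uniform_apply (x : ℤˣ) : (PMF.uniformOfFintype ℤˣ x).toReal = 2⁻¹ := by simp
  rw [channelEntropy, funext (W t).law_eq_withDensity, condEntropy_withDensity _
    (f := fun x y => likelihood x ((W t).softBit y))
    (fun x => (measurable_likelihood x).comp (W t).measurable_softBit)
    fun x y => likelihood_nonneg _ _]
  simp only [uniform_apply]
  rw [BMSChannel.integral_softLaw _ (f := fun d => weightEntropy fun x => 2⁻¹ * likelihood x d)
    (continuous_weightEntropy.measurable.comp
      (measurable_pi_lambda _ fun x => (measurable_likelihood x).const_mul _))]

theorem even_two_mul_add_two (n : ℕ) : Even (2 * n + 2) := ⟨n + 1, by ring⟩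

/-- The coefficients of the power series of the binary entropy function (in nats) around `1/2`. -/
noncomputable def entropyCoeff (n : ℕ) : ℝ := 1 / ((2 * n + 1) * (2 * n + 2))

theorem entropyCoeff_pos (n : ℕ) : 0 < entropyCoeff n := by
  unfold entropyCoeff
  positivity

theorem summable_entropyCoeff : Summable entropyCoeff := by
  have summable_inv_sq : Summable fun n : ℕ => 1 / ((n + 1 : ℕ) : ℝ) ^ 2 :=
    (summable_nat_add_iff (f := fun n : ℕ => 1 / (n : ℝ) ^ 2) 1).mpr
      (Real.summable_one_div_nat_pow.mpr one_lt_two)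
  refine summable_inv_sq.of_nonneg_of_le (fun n => (entropyCoeff_pos n).le) fun n => ?_
  refine one_div_le_one_div_of_le (by positivity) ?_
  push_cast
  nlinarith [n.cast_nonneg (α := ℝ)]

/-- The even part of `x ↦ negMulLog (1 + x)`. -/
noncomputable def symmNegMulLog (x : ℝ) : ℝ :=
  (Real.negMulLog (1 + x) + Real.negMulLog (1 - x)) / 2

theorem symmNegMulLog_neg (x : ℝ) : symmNegMulLog (-x) = symmNegMulLog x := by
  rw [symmNegMulLog, symmNegMulLog, sub_neg_eq_add, ← sub_eq_add_neg, add_comm]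

theorem negMulLog_mul_one_add_add_negMulLog_mul_one_sub (c x : ℝ) :
    Real.negMulLog (c * (1 + x)) + Real.negMulLog (c * (1 - x)) =
      2 * (Real.negMulLog c + c * symmNegMulLog x) := by
  rw [Real.negMulLog_mul, Real.negMulLog_mul, symmNegMulLog]
  ring

theorem hasSum_symmNegMulLog_of_abs_lt_one {x : ℝ} (hx : |x| < 1) :
    HasSum (fun n : ℕ => entropyCoeff n * x ^ (2 * n + 2)) (-symmNegMulLog x) := by
  have abs_sq_lt_one : |x ^ 2| < 1 := by
    rw [abs_pow]
    exact pow_lt_one₀ (abs_nonneg x) hx two_ne_zero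
  have log_one_sub_sq : Real.log (1 - x ^ 2) = Real.log (1 + x) + Real.log (1 - x) := by
    rw [← Real.log_mul (by linarith [(abs_lt.mp hx).1]) (by linarith [(abs_lt.mp hx).2])]
    ring_nf
  have hasSum_logs := (((Real.hasSum_log_sub_log_of_abs_lt_one hx).mul_left x).sub
    (Real.hasSum_pow_div_log_of_abs_lt_one abs_sq_lt_one)).div_const 2
  have sum_eq : (x * (Real.log (1 + x) - Real.log (1 - x)) - -Real.log (1 - x ^ 2)) / 2 =
      -symmNegMulLog x := by
    rw [log_one_sub_sq, symmNegMulLog, Real.negMulLog, Real.negMulLog]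
    ring
  rw [← sum_eq]
  refine hasSum_logs.congr_fun fun n => ?_
  unfold entropyCoeff
  field_simp
  ring

/-- At the endpoints `|x| = 1` both sides are continuous and agree in the interior. -/
theorem hasSum_symmNegMulLog {x : ℝ} (hx : |x| ≤ 1) :
    HasSum (fun n : ℕ => entropyCoeff n * x ^ (2 * n + 2)) (-symmNegMulLog x) := by
  have norm_term_le (n : ℕ) (y : ℝ) (hy : y ∈ Icc (-1 : ℝ) 1) :
      ‖entropyCoeff n * y ^ (2 * n + 2)‖ ≤ entropyCoeff n := by
    rw [norm_mul, norm_pow, Real.norm_of_nonneg (entropyCoeff_pos n).le]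
    exact mul_le_of_le_one_right (entropyCoeff_pos n).le
      (pow_le_one₀ (norm_nonneg _) (abs_le.mpr hy))
  have continuousOn_series : ContinuousOn
      (fun y : ℝ => ∑' n : ℕ, entropyCoeff n * y ^ (2 * n + 2)) (Icc (-1) 1) :=
    continuousOn_tsum (fun n => by fun_prop) summable_entropyCoeff norm_term_le
  have continuous_symm : Continuous fun y : ℝ => -symmNegMulLog y := by
    unfold symmNegMulLog
    fun_prop
  have eqOn_interior : EqOn (fun y : ℝ => ∑' n : ℕ, entropyCoeff n * y ^ (2 * n + 2))
      (fun y => -symmNegMulLog y) (Ioo (-1) 1) := fun y hy =>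
    (hasSum_symmNegMulLog_of_abs_lt_one (abs_lt.mpr hy)).tsum_eq
  have tsum_eq : ∑' n : ℕ, entropyCoeff n * x ^ (2 * n + 2) = -symmNegMulLog x :=
    eqOn_interior.of_subset_closure continuousOn_series continuous_symm.continuousOn
      Ioo_subset_Icc_self (closure_Ioo (by norm_num)).superset (abs_le.mp hx)
  rw [← tsum_eq]
  exact (Summable.of_norm_bounded summable_entropyCoeff
    fun n => norm_term_le n x (abs_le.mp hx)).hasSum

/-- Bernoulli's inequality applied to `|x / y|`. -/
theorem even_pow_tangent (n : ℕ) (x y : ℝ) :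
    (2 * n + 2) * y ^ (2 * n + 1) * x - (2 * n + 1) * y ^ (2 * n + 2) ≤ x ^ (2 * n + 2) := by
  rcases eq_or_ne y 0 with rfl | hy
  · simpa using (even_two_mul_add_two n).pow_nonneg x
  have bernoulli := one_add_mul_le_pow (a := |x / y| - 1) (by linarith [abs_nonneg (x / y)])
    (2 * n + 2)
  rw [add_sub_cancel, (even_two_mul_add_two n).pow_abs] at bernoulli
  push_cast at bernoulli
  have ratio_bound : 1 + (2 * n + 2) * (x / y - 1) ≤ (x / y) ^ (2 * n + 2) := by
    nlinarith [le_abs_self (x / y), n.cast_nonneg (α := ℝ)]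
  calc (2 * n + 2) * y ^ (2 * n + 1) * x - (2 * n + 1) * y ^ (2 * n + 2)
      = (1 + (2 * n + 2) * (x / y - 1)) * y ^ (2 * n + 2) := by
        field_simp
        ring
    _ ≤ (x / y) ^ (2 * n + 2) * y ^ (2 * n + 2) :=
        mul_le_mul_of_nonneg_right ratio_bound ((even_two_mul_add_two n).pow_nonneg y)
    _ = x ^ (2 * n + 2) := by rw [← mul_pow, div_mul_cancel₀ x hy]

section Observe

variable {A : Type*}

/-- The weights `v` after one more observation of the sign `ε`, with soft bit `d`. -/
noncomputable def observe (ε : A → ℤˣ) (v : A → ℝ) (d : SoftBit) (a : A) : ℝ :=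
  v a * likelihood (ε a) d

variable (ε : A → ℤˣ) {v : A → ℝ}

theorem observe_nonneg (hv : ∀ a, 0 ≤ v a) (d : SoftBit) (a : A) : 0 ≤ observe ε v d a :=
  mul_nonneg (hv a) (likelihood_nonneg _ _)

theorem observe_le {C : ℝ} (hv : ∀ a, 0 ≤ v a) (hvC : ∀ a, v a ≤ C) (d : SoftBit) (a : A) :
    observe ε v d a ≤ C * 2 :=
  mul_le_mul (hvC a) (likelihood_le_two _ _) (likelihood_nonneg _ _) ((hv a).trans (hvC a))

theorem negMulLog_observe_add_negMulLog_observe_reflect (v : A → ℝ) (d : SoftBit) (a : A) :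
    Real.negMulLog (observe ε v d a) + Real.negMulLog (observe ε v d.reflect a) =
      2 * (Real.negMulLog (v a) + v a * symmNegMulLog d) := by
  have symm_sign : symmNegMulLog (((ε a : ℤ) : ℝ) * d) = symmNegMulLog d := by
    rcases Int.units_eq_one_or (ε a) with h | h <;> simp [h, symmNegMulLog_neg]
  rw [← symm_sign, ← negMulLog_mul_one_add_add_negMulLog_mul_one_sub]
  simp only [observe, likelihood, SoftBit.reflect, mul_neg, sub_eq_add_neg]

theorem measurable_observe {X : Type*} [MeasurableSpace X] {q : X → A → ℝ}
    (hq : Measurable q) : Measurable fun z : X × SoftBit => observe ε (q z.1) z.2 :=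
  measurable_pi_lambda _ fun a => ((measurable_pi_apply a).comp (hq.comp measurable_fst)).mul
    ((measurable_likelihood (ε a)).comp measurable_snd)

end Observe

section Bias

variable {A : Type*} [Fintype A]

/-- The total of the weights `v`, counted with the signs `ε`. -/
noncomputable def signedSum (ε : A → ℤˣ) (v : A → ℝ) : ℝ := ∑ a, ((ε a : ℤ) : ℝ) * v a

/-- The mean of the sign `ε` under the normalized weights `v` (zero if all weights vanish). -/
noncomputable def bias (ε : A → ℤˣ) (v : A → ℝ) : ℝ := signedSum ε v / ∑ a, v a

/-- The even powers of the bias, extended to be homogeneous of degree one in the weights. -/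
noncomputable def biasMoment (ε : A → ℤˣ) (n : ℕ) (v : A → ℝ) : ℝ :=
  (∑ a, v a) * bias ε v ^ (2 * n + 2)

variable (ε : A → ℤˣ) {v : A → ℝ}

theorem abs_signedSum_le (hv : ∀ a, 0 ≤ v a) : |signedSum ε v| ≤ ∑ a, v a := by
  refine (Finset.abs_sum_le_sum_abs _ _).trans (Finset.sum_le_sum fun a _ => ?_)
  rcases Int.units_eq_one_or (ε a) with h | h <;> simp [h, abs_of_nonneg (hv a)]

theorem abs_bias_le_one (hv : ∀ a, 0 ≤ v a) : |bias ε v| ≤ 1 := by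
  have sum_nonneg : 0 ≤ ∑ a, v a := Finset.sum_nonneg fun a _ => hv a
  rw [bias, abs_div, abs_of_nonneg sum_nonneg]
  exact div_le_one_of_le₀ (abs_signedSum_le ε hv) sum_nonneg

theorem sum_mul_bias (hv : ∀ a, 0 ≤ v a) : (∑ a, v a) * bias ε v = signedSum ε v :=
  mul_div_cancel_of_imp' fun h => abs_nonpos_iff.mp ((abs_signedSum_le ε hv).trans_eq h)

theorem biasMoment_nonneg (hv : ∀ a, 0 ≤ v a) (n : ℕ) : 0 ≤ biasMoment ε n v :=
  mul_nonneg (Finset.sum_nonneg fun a _ => hv a) ((even_two_mul_add_two n).pow_nonneg _)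

theorem biasMoment_le (hv : ∀ a, 0 ≤ v a) (n : ℕ) : biasMoment ε n v ≤ ∑ a, v a := by
  refine mul_le_of_le_one_right (Finset.sum_nonneg fun a _ => hv a) ?_
  rw [← (even_two_mul_add_two n).pow_abs]
  exact pow_le_one₀ (abs_nonneg _) (abs_bias_le_one ε hv)

theorem measurable_bias : Measurable (bias ε) := by
  unfold bias signedSum
  fun_prop

theorem measurable_biasMoment (n : ℕ) : Measurable (biasMoment ε n) :=
  (Finset.measurable_fun_sum _ fun a _ => measurable_pi_apply a).mul
    ((measurable_bias ε).pow_const _)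

theorem sum_observe (hv : ∀ a, 0 ≤ v a) (d : SoftBit) :
    ∑ a, observe ε v d a = (∑ a, v a) * (1 + bias ε v * d) := by
  rw [mul_add, mul_one, ← mul_assoc, sum_mul_bias ε hv, signedSum, Finset.sum_mul,
    ← Finset.sum_add_distrib]
  refine Finset.sum_congr rfl fun a _ => ?_
  rw [observe, likelihood]
  ring

theorem weightEntropy_sub_observe (hv : ∀ a, 0 ≤ v a) (d : SoftBit) :
    weightEntropy v -
        (weightEntropy (observe ε v d) + weightEntropy (observe ε v d.reflect)) / 2 =
      (∑ a, v a) * (symmNegMulLog (bias ε v * d) - symmNegMulLog d) := by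
  have sum_terms := Finset.sum_congr (rfl : (Finset.univ : Finset A) = Finset.univ) fun a _ =>
    negMulLog_observe_add_negMulLog_observe_reflect ε v d a
  rw [Finset.sum_add_distrib, ← Finset.mul_sum, Finset.sum_add_distrib, ← Finset.sum_mul]
    at sum_terms
  have total := negMulLog_mul_one_add_add_negMulLog_mul_one_sub (∑ a, v a) (bias ε v * d)
  simp only [weightEntropy, sum_observe ε hv, SoftBit.reflect, mul_neg, ← sub_eq_add_neg]
  simp only [SoftBit.reflect] at sum_terms
  linear_combination (-1 / 2 : ℝ) * sum_terms + (1 / 2 : ℝ) * total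

theorem hasSum_weightEntropy_sub_observe (hv : ∀ a, 0 ≤ v a) (d : SoftBit) :
    HasSum (fun n => (∑ a, v a - biasMoment ε n v) * (entropyCoeff n * (d : ℝ) ^ (2 * n + 2)))
      (weightEntropy v -
        (weightEntropy (observe ε v d) + weightEntropy (observe ε v d.reflect)) / 2) := by
  have abs_bias_mul_le_one : |bias ε v * d| ≤ 1 := by
    rw [abs_mul]
    exact mul_le_one₀ (abs_bias_le_one ε hv) (abs_nonneg _) d.abs_le_one
  rw [weightEntropy_sub_observe ε hv, ← neg_sub_neg]
  refine (((hasSum_symmNegMulLog d.abs_le_one).sub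
    (hasSum_symmNegMulLog abs_bias_mul_le_one)).mul_left (∑ a, v a)).congr_fun fun n => ?_
  rw [biasMoment, mul_pow]
  ring

/-- The tangent at bias `u` to the homogeneous function `biasMoment`, a linear function of the
weights. -/
noncomputable def biasTangent (n : ℕ) (u : ℝ) (v : A → ℝ) : ℝ :=
  (2 * n + 2) * u ^ (2 * n + 1) * signedSum ε v - (2 * n + 1) * u ^ (2 * n + 2) * ∑ a, v a

theorem biasTangent_add_smul (n : ℕ) (u c : ℝ) (v w : A → ℝ) :
    biasTangent ε n u (v + c • w) = biasTangent ε n u v + biasTangent ε n u w * c := by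
  simp only [biasTangent, signedSum, Pi.add_apply, Pi.smul_apply, smul_eq_mul, mul_add,
    mul_left_comm _ c, Finset.sum_add_distrib, ← Finset.mul_sum]
  ring

theorem continuous_biasTangent (n : ℕ) (v : A → ℝ) : Continuous fun u => biasTangent ε n u v := by
  unfold biasTangent
  fun_prop

theorem biasTangent_le_biasMoment (hv : ∀ a, 0 ≤ v a) (n : ℕ) (u : ℝ) :
    biasTangent ε n u v ≤ biasMoment ε n v := by
  refine le_trans (le_of_eq ?_) (mul_le_mul_of_nonneg_left (even_pow_tangent n (bias ε v) u)
    (Finset.sum_nonneg fun a _ => hv a))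
  rw [biasTangent, ← sum_mul_bias ε hv]
  ring

theorem biasTangent_bias (hv : ∀ a, 0 ≤ v a) (n : ℕ) :
    biasTangent ε n (bias ε v) v = biasMoment ε n v := by
  rw [biasTangent, biasMoment, ← sum_mul_bias ε hv]
  ring

theorem hasBoundedSubgradient_biasMoment (n : ℕ) {α β : A → ℝ}
    (h0 : ∀ (e : SoftBit) a, 0 ≤ (α + (e : ℝ) • β) a) :
    HasBoundedSubgradient fun e => biasMoment ε n (α + (e : ℝ) • β) := by
  have measurable_slope : Measurable fun e : SoftBit =>
      biasTangent ε n (bias ε (α + (e : ℝ) • β)) β :=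
    (continuous_biasTangent ε n β).measurable.comp
      ((measurable_bias ε).comp (by fun_prop))
  obtain ⟨C, hC⟩ := (isCompact_Icc (a := (-1 : ℝ)) (b := 1)).exists_bound_of_continuousOn
    (continuous_biasTangent ε n β).continuousOn
  refine ⟨_, C, measurable_slope, fun e => hC _ (abs_le.mp (abs_bias_le_one ε (h0 e))),
    fun e e₀ => ?_⟩
  calc biasMoment ε n (α + (e₀ : ℝ) • β) +
        biasTangent ε n (bias ε (α + (e₀ : ℝ) • β)) β * (e - e₀)
      = biasTangent ε n (bias ε (α + (e₀ : ℝ) • β)) (α + (e : ℝ) • β) := by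
        rw [← biasTangent_bias ε (h0 e₀)]
        simp only [biasTangent_add_smul]
        ring
    _ ≤ biasMoment ε n (α + (e : ℝ) • β) := biasTangent_le_biasMoment ε (h0 e) n _

end Bias

namespace SoftBit

theorem pow_mem (d : SoftBit) (n : ℕ) : (d : ℝ) ^ (2 * n + 2) ∈ Icc (0 : ℝ) 1 := by
  refine ⟨(even_two_mul_add_two n).pow_nonneg _, ?_⟩
  rw [← (even_two_mul_add_two n).pow_abs]
  exact pow_le_one₀ (abs_nonneg _) d.abs_le_one

theorem hasBoundedSubgradient_pow (n : ℕ) :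
    HasBoundedSubgradient fun d => (d : ℝ) ^ (2 * n + 2) := by
  refine ⟨fun d => (2 * n + 2) * (d : ℝ) ^ (2 * n + 1), 2 * n + 2, by fun_prop, fun d => ?_,
    fun d d₀ => (le_of_eq ?_).trans (even_pow_tangent n d d₀)⟩
  · have factor_nonneg : (0 : ℝ) ≤ 2 * n + 2 := by positivity
    rw [abs_mul, abs_pow, abs_of_nonneg factor_nonneg]
    exact mul_le_of_le_one_right factor_nonneg (pow_le_one₀ (abs_nonneg _) d.abs_le_one)
  · ring

end SoftBit

namespace BMSChannel

/-- The even moments of the soft bit. -/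
noncomputable def softMoment (V : BMSChannel) (n : ℕ) : ℝ :=
  ∫ d : SoftBit, (d : ℝ) ^ (2 * n + 2) ∂V.softLaw

theorem softMoment_nonneg (V : BMSChannel) (n : ℕ) : 0 ≤ V.softMoment n :=
  integral_nonneg fun d => (d.pow_mem n).1

theorem IsDegradedOf.softMoment_le {V W : BMSChannel} (h : V.IsDegradedOf W) (n : ℕ) :
    V.softMoment n ≤ W.softMoment n :=
  h.integral_softLaw_le (SoftBit.hasBoundedSubgradient_pow n)

end BMSChannel

theorem hasSum_integral_of_nonneg {α : Type*} [MeasurableSpace α] {μ : Measure α}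
    {F : ℕ → α → ℝ} {G : α → ℝ} (hF : ∀ n, AEStronglyMeasurable (F n) μ) (hF0 : ∀ n x, 0 ≤ F n x)
    (hG : Integrable G μ) (hFG : ∀ x, HasSum (fun n => F n x) (G x)) :
    HasSum (fun n => ∫ x, F n x ∂μ) (∫ x, G x ∂μ) := by
  refine hasSum_integral_of_dominated_convergence F hF
    (fun n => Eventually.of_forall fun x => (Real.norm_of_nonneg (hF0 n x)).le)
    (Eventually.of_forall fun x => (hFG x).summable) ?_ (Eventually.of_forall hFG)
  simpa only [(hFG _).tsum_eq] using hG

section EntropyLoss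

variable {A X : Type*} [Fintype A] [MeasurableSpace X] (P : Measure X) [IsProbabilityMeasure P]
  (V : BMSChannel) (ε : A → ℤˣ) {q : X → A → ℝ}

theorem measurePreserving_map_id_reflect :
    MeasurePreserving (Prod.map id SoftBit.reflect : X × SoftBit → X × SoftBit)
      (P.prod V.softLaw) (P.prod V.softLaw) :=
  (MeasurePreserving.id P).prod V.measurePreserving_reflect

variable {C : ℝ}

theorem integrable_weightEntropy_observe (hq : Measurable q) (hq0 : ∀ x a, 0 ≤ q x a)
    (hqC : ∀ x a, q x a ≤ C) :
    Integrable (fun z : X × SoftBit => weightEntropy (observe ε (q z.1) z.2))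
      (P.prod V.softLaw) :=
  integrable_weightEntropy (measurable_observe ε hq) (fun z => observe_nonneg ε (hq0 z.1) z.2)
    fun z => observe_le ε (hq0 z.1) (hqC z.1) z.2

theorem integral_weightEntropy_sub_observe (hq : Measurable q) (hq0 : ∀ x a, 0 ≤ q x a)
    (hqC : ∀ x a, q x a ≤ C) :
    Integrable (fun z : X × SoftBit => weightEntropy (q z.1) -
        (weightEntropy (observe ε (q z.1) z.2) + weightEntropy (observe ε (q z.1) z.2.reflect)) / 2)
      (P.prod V.softLaw) ∧
    ∫ z : X × SoftBit, (weightEntropy (q z.1) -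
        (weightEntropy (observe ε (q z.1) z.2) + weightEntropy (observe ε (q z.1) z.2.reflect)) / 2)
          ∂P.prod V.softLaw =
      ∫ x, weightEntropy (q x) ∂P -
        ∫ z, weightEntropy (observe ε (q z.1) z.2) ∂P.prod V.softLaw := by
  have reflect := measurePreserving_map_id_reflect P V
  have integrable_before : Integrable (fun z : X × SoftBit => weightEntropy (q z.1))
      (P.prod V.softLaw) := (integrable_weightEntropy hq hq0 hqC).comp_fst _
  have integrable_after := integrable_weightEntropy_observe P V ε hq hq0 hqC
  have integrable_reflect : Integrable (fun z : X × SoftBit =>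
      weightEntropy (observe ε (q z.1) z.2.reflect)) (P.prod V.softLaw) :=
    reflect.integrable_comp_of_integrable integrable_after
  have integral_reflect : ∫ z, weightEntropy (observe ε (q z.1) z.2.reflect) ∂P.prod V.softLaw =
      ∫ z, weightEntropy (observe ε (q z.1) z.2) ∂P.prod V.softLaw :=
    integral_comp_of_measurePreserving reflect integrable_after.aestronglyMeasurable
  have integrable_average := (integrable_after.fun_add integrable_reflect).div_const 2
  refine ⟨integrable_before.sub integrable_average, ?_⟩
  rw [integral_sub integrable_before integrable_average, integral_div,
    integral_add integrable_after integrable_reflect, integral_reflect,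
    integral_fun_fst (fun x => weightEntropy (q x)), probReal_univ, one_smul, add_self_div_two]

theorem hasSum_integral_weightEntropy_sub_observe (hq : Measurable q) (hq0 : ∀ x a, 0 ≤ q x a)
    (hqC : ∀ x a, q x a ≤ C) :
    HasSum (fun n => entropyCoeff n * V.softMoment n *
        ∫ x, (∑ a, q x a - biasMoment ε n (q x)) ∂P)
      (∫ x, weightEntropy (q x) ∂P -
        ∫ z, weightEntropy (observe ε (q z.1) z.2) ∂P.prod V.softLaw) := by
  have measurable_loss n : Measurable fun x => ∑ a, q x a - biasMoment ε n (q x) :=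
    (Finset.measurable_fun_sum _ fun a _ => (measurable_pi_apply a).comp hq).sub
      ((measurable_biasMoment ε n).comp hq)
  have measurable_pow n : Measurable fun d : SoftBit => entropyCoeff n * (d : ℝ) ^ (2 * n + 2) := by
    fun_prop
  obtain ⟨integrable_loss, integral_loss⟩ := integral_weightEntropy_sub_observe P V ε hq hq0 hqC
  rw [← integral_loss]
  refine (hasSum_integral_of_nonneg (fun n => (((measurable_loss n).comp measurable_fst).mul
    ((measurable_pow n).comp measurable_snd)).aestronglyMeasurable)
    (fun n z => mul_nonneg (sub_nonneg.mpr (biasMoment_le ε (hq0 z.1) n))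
      (mul_nonneg (entropyCoeff_pos n).le (z.2.pow_mem n).1)) integrable_loss
    fun z => hasSum_weightEntropy_sub_observe ε (hq0 z.1) z.2).congr_fun fun n => ?_
  refine Eq.trans ?_ (integral_prod_mul (fun x => ∑ a, q x a - biasMoment ε n (q x))
    (fun d : SoftBit => entropyCoeff n * (d : ℝ) ^ (2 * n + 2))).symm
  rw [integral_const_mul, BMSChannel.softMoment, mul_comm]

end EntropyLoss

/-- The soft bit of an erased observation. -/
def SoftBit.zero : SoftBit := ⟨0, by norm_num, by norm_num⟩

@[simp]
theorem likelihood_zero (x : ℤˣ) : likelihood x SoftBit.zero = 1 := by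
  simp [likelihood, SoftBit.zero]

theorem BMSChannel.integral_likelihood (V : BMSChannel) (x : ℤˣ) :
    ∫ d, likelihood x d ∂V.softLaw = 1 := by
  have integrable_coe : Integrable (fun d : SoftBit => (d : ℝ)) V.softLaw :=
    integrable_of_abs_le measurable_subtype_coe SoftBit.abs_le_one
  simp only [likelihood]
  rw [integral_add (integrable_const _) (integrable_coe.const_mul _), integral_const_mul,
    V.integral_softLaw_coe, mul_zero, add_zero, integral_const, probReal_univ, one_smul]

theorem HasBoundedSubgradient.apply_zero_le_integral {f : SoftBit → ℝ}
    (hf : HasBoundedSubgradient f) (V : BMSChannel) : f SoftBit.zero ≤ ∫ d, f d ∂V.softLaw := by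
  have integrable_f := hf.integrable V.softLaw
  obtain ⟨g, -, -, -, tangent⟩ := hf
  have integrable_coe : Integrable (fun d : SoftBit => (d : ℝ)) V.softLaw :=
    integrable_of_abs_le measurable_subtype_coe SoftBit.abs_le_one
  calc f SoftBit.zero
      = ∫ d : SoftBit, (f SoftBit.zero + g SoftBit.zero * d) ∂V.softLaw := by
        rw [integral_add (integrable_const _) (integrable_coe.const_mul _), integral_const_mul,
          V.integral_softLaw_coe, mul_zero, add_zero, integral_const, probReal_univ, one_smul]
    _ ≤ ∫ d, f d ∂V.softLaw :=
        integral_mono ((integrable_const _).add (integrable_coe.const_mul _)) integrable_f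
          fun d => by simpa [SoftBit.zero] using tangent d SoftBit.zero

section Resampling

variable {ι : Type*} [Fintype ι]

theorem measurePreserving_update [DecidableEq ι] (W : ℝ → BMSChannel) (τ : ι → ℝ) (k : ι) (s : ℝ) :
    MeasurePreserving (fun z : (ι → SoftBit) × SoftBit => Function.update z.1 k z.2)
      ((softLawPi W τ).prod (W s).softLaw) (softLawPi W (Function.update τ k s)) := by
  refine ⟨measurable_update', (Measure.pi_eq fun S hS => ?_).symm⟩
  have preimage_pi : (fun z : (ι → SoftBit) × SoftBit => Function.update z.1 k z.2) ⁻¹' univ.pi S =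
      (univ.pi (Function.update S k univ)) ×ˢ S k := by
    ext z
    simp [Function.forall_update_iff z.1 fun l e => e ∈ S l,
      Function.forall_update_iff S fun l T => z.1 l ∈ T, and_comm]
  rw [Measure.map_apply measurable_update' (MeasurableSet.univ_pi hS), preimage_pi,
    Measure.prod_prod, softLawPi, Measure.pi_pi, mul_comm,
    ← Finset.mul_prod_erase _ _ (Finset.mem_univ k),
    ← Finset.mul_prod_erase _ _ (Finset.mem_univ k)]
  simp only [Function.update_self, measure_univ, one_mul]
  congr 1
  refine Finset.prod_congr rfl fun l hl => ?_
  simp only [Function.update_of_ne (Finset.ne_of_mem_erase hl)]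

theorem measurePreserving_comp_some (W : ℝ → BMSChannel) (τ : Option ι → ℝ) :
    MeasurePreserving (fun (d : Option ι → SoftBit) i => d (some i))
      (softLawPi W τ) (softLawPi W fun i => τ (some i)) := by
  have measurable_comp_some : Measurable fun (d : Option ι → SoftBit) i => d (some i) := by
    fun_prop
  refine ⟨measurable_comp_some, (Measure.pi_eq fun S hS => ?_).symm⟩
  have preimage_pi : (fun (d : Option ι → SoftBit) i => d (some i)) ⁻¹' univ.pi S =
      univ.pi fun o : Option ι => o.elim univ S := by
    ext d
    simp [Option.forall]
  rw [Measure.map_apply measurable_comp_some (MeasurableSet.univ_pi hS), preimage_pi, softLawPi,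
    Measure.pi_pi, Fintype.prod_option]
  simp

end Resampling

section Extrinsic

variable {N : ℕ} {ι : Type*} [Fintype ι] [DecidableEq ι] (p : PMF (Fin N → ℤˣ))
  (W : ℝ → BMSChannel) (σ : ι → Fin N) (k l : ι)

/-- The joint weights when observation `k` is erased. -/
noncomputable def extrinsicWeight (d : ι → SoftBit) : (Fin N → ℤˣ) → ℝ :=
  jointWeight p σ (Function.update d k SoftBit.zero)

/-- The bias moment of the input bit seen by observation `k`, when that observation is erased. -/
noncomputable def extrinsicBias (n : ℕ) (d : ι → SoftBit) : ℝ :=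
  biasMoment (fun x => x (σ k)) n (extrinsicWeight p σ k d)

/-- The mean bias moment of the input bit seen by observation `k`, given all other
observations. -/
noncomputable def extrinsicMoment (τ : ι → ℝ) (n : ℕ) : ℝ :=
  ∫ d, extrinsicBias p σ k n d ∂softLawPi W τ

theorem jointWeight_update (d : ι → SoftBit) (e : SoftBit) :
    jointWeight p σ (Function.update d k e) =
      observe (fun x => x (σ k)) (extrinsicWeight p σ k d) e := by
  have vectorLikelihood_update (x : Fin N → ℤˣ) (e : SoftBit) :
      vectorLikelihood σ x (Function.update d k e) =
        likelihood (x (σ k)) e * ∏ l ∈ Finset.univ.erase k, likelihood (x (σ l)) (d l) := by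
    rw [vectorLikelihood, ← Finset.mul_prod_erase _ _ (Finset.mem_univ k), Function.update_self]
    congr 1
    refine Finset.prod_congr rfl fun l hl => ?_
    rw [Function.update_of_ne (Finset.ne_of_mem_erase hl)]
  ext x
  rw [observe, extrinsicWeight, jointWeight, jointWeight, vectorLikelihood_update x e,
    vectorLikelihood_update x SoftBit.zero, likelihood_zero]
  ring

theorem extrinsicWeight_nonneg (d : ι → SoftBit) (x : Fin N → ℤˣ) :
    0 ≤ extrinsicWeight p σ k d x :=
  jointWeight_nonneg _ _ _ _

theorem extrinsicWeight_le (d : ι → SoftBit) (x : Fin N → ℤˣ) :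
    extrinsicWeight p σ k d x ≤ 2 ^ Fintype.card ι :=
  jointWeight_le _ _ _ _

theorem measurable_extrinsicWeight : Measurable (extrinsicWeight p σ k) :=
  (measurable_jointWeight p σ).comp measurable_update_left

theorem integral_vectorLikelihood_update_zero (τ : ι → ℝ) (x : Fin N → ℤˣ) :
    ∫ d, vectorLikelihood σ x (Function.update d k SoftBit.zero) ∂softLawPi W τ = 1 := by
  have factor (d : ι → SoftBit) : vectorLikelihood σ x (Function.update d k SoftBit.zero) =
      ∏ l, (fun l (e : SoftBit) => if l = k then 1 else likelihood (x (σ l)) e) l (d l) := by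
    refine Finset.prod_congr rfl fun l _ => ?_
    by_cases hl : l = k
    · subst hl
      simp
    · simp [hl]
  rw [funext factor, softLawPi, integral_fintype_prod_eq_prod
    (f := fun l (e : SoftBit) => if l = k then 1 else likelihood (x (σ l)) e)]
  refine Finset.prod_eq_one fun l _ => ?_
  by_cases hl : l = k <;> simp [hl, BMSChannel.integral_likelihood]

theorem integrable_extrinsicWeight (τ : ι → ℝ) (x : Fin N → ℤˣ) :
    Integrable (fun d => extrinsicWeight p σ k d x) (softLawPi W τ) :=
  integrable_of_abs_le (C := 2 ^ Fintype.card ι)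
    ((measurable_pi_apply x).comp (measurable_extrinsicWeight p σ k)) fun d => by
      rw [abs_of_nonneg (extrinsicWeight_nonneg p σ k d x)]
      exact extrinsicWeight_le p σ k d x

theorem integral_sum_extrinsicWeight (τ : ι → ℝ) :
    ∫ d, ∑ x, extrinsicWeight p σ k d x ∂softLawPi W τ = 1 := by
  have integral_eq x : ∫ d, extrinsicWeight p σ k d x ∂softLawPi W τ = (p x).toReal := by
    simp only [extrinsicWeight, jointWeight]
    rw [integral_const_mul, integral_vectorLikelihood_update_zero, mul_one]
  have sum_prob : ∑ x, p x = 1 := by rw [← p.tsum_coe, tsum_fintype]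
  rw [integral_finsetSum _ fun x _ => integrable_extrinsicWeight p W σ k τ x]
  simp only [integral_eq]
  rw [← ENNReal.toReal_sum fun x _ => p.apply_ne_top x, sum_prob, ENNReal.toReal_one]

variable (n : ℕ)

theorem extrinsicBias_mem (d : ι → SoftBit) :
    extrinsicBias p σ k n d ∈ Icc 0 (∑ x, extrinsicWeight p σ k d x) :=
  ⟨biasMoment_nonneg _ (extrinsicWeight_nonneg p σ k d) n,
    biasMoment_le _ (extrinsicWeight_nonneg p σ k d) n⟩

theorem measurable_extrinsicBias : Measurable (extrinsicBias p σ k n) :=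
  (measurable_biasMoment _ n).comp (measurable_extrinsicWeight p σ k)

theorem abs_extrinsicBias_le (d : ι → SoftBit) :
    |extrinsicBias p σ k n d| ≤ ∑ _x : Fin N → ℤˣ, (2 : ℝ) ^ Fintype.card ι := by
  have hmem := extrinsicBias_mem p σ k n d
  rw [abs_of_nonneg hmem.1]
  exact hmem.2.trans (Finset.sum_le_sum fun x _ => extrinsicWeight_le p σ k d x)

theorem integrable_extrinsicBias (μ : Measure (ι → SoftBit)) [IsFiniteMeasure μ] :
    Integrable (extrinsicBias p σ k n) μ :=
  integrable_of_abs_le (measurable_extrinsicBias p σ k n) (abs_extrinsicBias_le p σ k n)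

theorem integrable_extrinsicBias_update (μ : Measure ((ι → SoftBit) × SoftBit))
    [IsFiniteMeasure μ] :
    Integrable (fun z => extrinsicBias p σ k n (Function.update z.1 l z.2)) μ :=
  integrable_of_abs_le ((measurable_extrinsicBias p σ k n).comp measurable_update')
    fun _ => abs_extrinsicBias_le p σ k n _

theorem extrinsicMoment_mem (τ : ι → ℝ) : extrinsicMoment p W σ k τ n ∈ Icc (0 : ℝ) 1 := by
  refine ⟨integral_nonneg fun d => (extrinsicBias_mem p σ k n d).1, ?_⟩
  rw [← integral_sum_extrinsicWeight p W σ k τ]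
  exact integral_mono (integrable_extrinsicBias p σ k n _)
    (integrable_finsetSum _ fun x _ => integrable_extrinsicWeight p W σ k τ x)
    fun d => (extrinsicBias_mem p σ k n d).2

theorem extrinsicMoment_update (τ : ι → ℝ) (s : ℝ) :
    extrinsicMoment p W σ k (Function.update τ l s) n =
      ∫ d, ∫ e, extrinsicBias p σ k n (Function.update d l e) ∂(W s).softLaw ∂softLawPi W τ := by
  rw [extrinsicMoment, ← integral_comp_of_measurePreserving (measurePreserving_update W τ l s)
    (measurable_extrinsicBias p σ k n).aestronglyMeasurable]
  exact integral_prod _ (integrable_extrinsicBias_update p σ k l n _)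

theorem exists_extrinsicWeight_update_eq (d : ι → SoftBit) : ∃ α β : (Fin N → ℤˣ) → ℝ,
    ∀ e : SoftBit, extrinsicWeight p σ k (Function.update d l e) = α + (e : ℝ) • β := by
  by_cases hl : l = k
  · subst hl
    exact ⟨extrinsicWeight p σ l d, 0, fun e => by simp [extrinsicWeight]⟩
  · refine ⟨extrinsicWeight p σ l (Function.update d k SoftBit.zero), fun x =>
      ((x (σ l) : ℤ) : ℝ) * extrinsicWeight p σ l (Function.update d k SoftBit.zero) x,
      fun e => ?_⟩
    rw [extrinsicWeight, Function.update_comm hl, jointWeight_update]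
    ext x
    simp only [observe, likelihood, Pi.add_apply, Pi.smul_apply, smul_eq_mul]
    ring

theorem hasBoundedSubgradient_extrinsicBias_update (d : ι → SoftBit) :
    HasBoundedSubgradient fun e => extrinsicBias p σ k n (Function.update d l e) := by
  obtain ⟨α, β, affine⟩ := exists_extrinsicWeight_update_eq p σ k l d
  simp only [extrinsicBias, affine]
  refine hasBoundedSubgradient_biasMoment _ n fun e x => ?_
  rw [← affine]
  exact extrinsicWeight_nonneg _ _ _ _ _

theorem extrinsicMoment_update_le {W : ℝ → BMSChannel} (τ : ι → ℝ) {s t : ℝ}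
    (h : (W t).IsDegradedOf (W s)) :
    extrinsicMoment p W σ k (Function.update τ l t) n ≤
      extrinsicMoment p W σ k (Function.update τ l s) n := by
  rw [extrinsicMoment_update, extrinsicMoment_update]
  exact integral_mono (integrable_extrinsicBias_update p σ k l n _).integral_prod_left
    (integrable_extrinsicBias_update p σ k l n _).integral_prod_left fun d =>
      h.integral_softLaw_le (hasBoundedSubgradient_extrinsicBias_update p σ k l n d)

theorem integral_extrinsicBias_update_zero_le (τ : ι → ℝ) :
    ∫ d, extrinsicBias p σ k n (Function.update d l SoftBit.zero) ∂softLawPi W τ ≤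
      extrinsicMoment p W σ k τ n := by
  conv_rhs => rw [← Function.update_eq_self l τ]
  rw [extrinsicMoment_update]
  exact integral_mono (integrable_of_abs_le
      ((measurable_extrinsicBias p σ k n).comp measurable_update_left)
      fun _ => abs_extrinsicBias_le p σ k n _)
    (integrable_extrinsicBias_update p σ k l n _).integral_prod_left fun d =>
      (hasBoundedSubgradient_extrinsicBias_update p σ k l n d).apply_zero_le_integral _

end Extrinsic

theorem log_two_pos : 0 < Real.log 2 := Real.log_pos one_lt_two

/-- The coefficients of the expansion of the binary entropy in bits. -/
noncomputable def bitCoeff (n : ℕ) : ℝ := entropyCoeff n / Real.log 2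

theorem bitCoeff_nonneg (n : ℕ) : 0 ≤ bitCoeff n :=
  (div_pos (entropyCoeff_pos n) log_two_pos).le

section ChannelEntropy

variable (W : ℝ → BMSChannel) (t : ℝ)

theorem signedSum_id_const (c : ℝ) : signedSum (id : ℤˣ → ℤˣ) (fun _ => c) = 0 := by
  simp [signedSum, UnitsInt.univ]

theorem hasSum_channelEntropy :
    HasSum (fun n => bitCoeff n * (W t).softMoment n) (1 - channelEntropy W t) := by
  have sum_half : ∑ _x : ℤˣ, (2⁻¹ : ℝ) = 1 := by simp
  have biasMoment_half n : biasMoment (id : ℤˣ → ℤˣ) n (fun _ => 2⁻¹) = 0 := by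
    simp [biasMoment, bias, signedSum_id_const]
  have entropy_half : weightEntropy (fun _ : ℤˣ => (2⁻¹ : ℝ)) = Real.log 2 := by
    rw [weightEntropy, sum_half]
    simp [Real.negMulLog]
  have integral_observe : ∫ z : Unit × SoftBit, weightEntropy (observe id (fun _ => 2⁻¹) z.2)
      ∂(Measure.dirac ()).prod (W t).softLaw =
        ∫ d, weightEntropy (fun x => 2⁻¹ * likelihood x d) ∂(W t).softLaw := by
    rw [integral_fun_snd fun d => weightEntropy (observe id (fun _ => 2⁻¹) d), probReal_univ,
      one_smul]
    rfl
  have hasSum_loss := (hasSum_integral_weightEntropy_sub_observe (Measure.dirac ()) (W t)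
    (id : ℤˣ → ℤˣ) (q := fun _ _ => 2⁻¹) (C := 2⁻¹) measurable_const (fun _ _ => by norm_num)
    fun _ _ => le_rfl).div_const (Real.log 2)
  simp only [sum_half, biasMoment_half, entropy_half, integral_dirac, sub_zero, mul_one]
    at hasSum_loss
  rw [integral_observe, sub_div, div_self log_two_pos.ne', ← channelEntropy_eq_integral]
    at hasSum_loss
  exact hasSum_loss.congr_fun fun n => by rw [bitCoeff, div_mul_eq_mul_div]

theorem channelEntropy_nonneg : 0 ≤ channelEntropy W t := by
  rw [channelEntropy_eq_integral]
  refine div_nonneg (integral_nonneg fun d => ?_) log_two_pos.le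
  have sum_eq_one : ∑ x, 2⁻¹ * likelihood x d = 1 := by
    rw [← Finset.mul_sum, UnitsInt.univ, Finset.sum_pair (by decide),
      likelihood_one_add_likelihood_neg_one, inv_mul_cancel₀ two_ne_zero]
  have le_one x : 2⁻¹ * likelihood x d ≤ 1 := by linarith [likelihood_le_two x d]
  change 0 ≤ weightEntropy _
  rw [weightEntropy, sum_eq_one, Real.negMulLog_one, sub_zero]
  exact Finset.sum_nonneg fun x _ =>
    Real.negMulLog_nonneg (mul_nonneg (by norm_num) (likelihood_nonneg x d)) (le_one x)

end ChannelEntropy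

/-- A family of channels ordered by degradation on `[0, 1]`, with absolutely continuous entropy
function; nothing is required of the channels at the endpoints. -/
structure IsACOrderedFamily (W : ℝ → BMSChannel) : Prop where
  degraded : ∀ s t : ℝ, 0 ≤ s → s ≤ t → t ≤ 1 → (W t).IsDegradedOf (W s)
  absolutelyContinuous : AbsolutelyContinuousOnInterval (channelEntropy W) 0 1

/-- The terms of the expansion of the channel entropy in soft moments, up to its constant `1`;
the sign makes them increase with the parameter. -/
noncomputable def entropyTerm (W : ℝ → BMSChannel) (n : ℕ) (t : ℝ) : ℝ :=
  -(bitCoeff n * (W t).softMoment n)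

theorem IsACOrderedFamily.isMonotoneSeries {W : ℝ → BMSChannel} (hW : IsACOrderedFamily W) :
    IsMonotoneSeries (entropyTerm W) (channelEntropy W) 0 1 where
  le := zero_le_one
  monotoneOn n _ hs _ ht hst := neg_le_neg (mul_le_mul_of_nonneg_left
    ((hW.degraded _ _ hs.1 hst ht.2).softMoment_le n) (bitCoeff_nonneg n))
  hasSum_sub s _ t _ := by
    have hasSum_sub := (hasSum_channelEntropy W s).sub (hasSum_channelEntropy W t)
    rw [sub_sub_sub_cancel_left] at hasSum_sub
    exact hasSum_sub.congr_fun fun n => by rw [entropyTerm, entropyTerm, neg_sub_neg]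
  absolutelyContinuous := hW.absolutelyContinuous

section Gexit

variable {N : ℕ} {ι : Type*} [Fintype ι] [DecidableEq ι] (p : PMF (Fin N → ℤˣ))

/-- The weights of the expansion of the conditional entropy in the soft moments of
observation `k`. -/
noncomputable def gexitWeight (W : ℝ → BMSChannel) (σ : ι → Fin N) (k : ι) (τ : ι → ℝ)
    (n : ℕ) : ℝ :=
  1 - extrinsicMoment p W σ k τ n

theorem gexitWeight_mem (W : ℝ → BMSChannel) (σ : ι → Fin N) (k : ι) (τ : ι → ℝ) (n : ℕ) :
    gexitWeight p W σ k τ n ∈ Icc (0 : ℝ) 1 :=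
  Set.sub_mem_Icc_zero_iff_right.mpr (extrinsicMoment_mem p W σ k n τ)

theorem hasSum_condEntropy_update (W : ℝ → BMSChannel) (σ : ι → Fin N) (k : ι) (τ : ι → ℝ)
    (s : ℝ) :
    HasSum (fun n => bitCoeff n * (W s).softMoment n * gexitWeight p W σ k τ n)
      ((∫ d, weightEntropy (extrinsicWeight p σ k d) ∂softLawPi W τ) / Real.log 2 -
        condEntropy p (observationLaw W σ (Function.update τ k s))) := by
  have integral_loss n : ∫ d, (∑ x, extrinsicWeight p σ k d x -
      biasMoment (fun x => x (σ k)) n (extrinsicWeight p σ k d)) ∂softLawPi W τ =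
        gexitWeight p W σ k τ n := by
    simp only [← extrinsicBias.eq_def]
    rw [integral_sub (integrable_finsetSum _ fun x _ => integrable_extrinsicWeight p W σ k τ x)
      (integrable_extrinsicBias p σ k n _), integral_sum_extrinsicWeight]
    rfl
  have hasSum_loss := (hasSum_integral_weightEntropy_sub_observe (softLawPi W τ) (W s)
    (fun x : Fin N → ℤˣ => x (σ k)) (measurable_extrinsicWeight p σ k)
    (extrinsicWeight_nonneg p σ k) (extrinsicWeight_le p σ k)).div_const (Real.log 2)
  simp only [← jointWeight_update, integral_loss] at hasSum_loss
  rw [integral_comp_of_measurePreserving (measurePreserving_update W τ k s)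
    (measurable_weightEntropy_jointWeight p σ).aestronglyMeasurable, sub_div,
    ← condEntropy_observationLaw] at hasSum_loss
  exact hasSum_loss.congr_fun fun n => by rw [bitCoeff]; ring

theorem extrinsicMoment_antitoneOn {W : ℝ → BMSChannel} (hW : IsACOrderedFamily W)
    (σ : ι → Fin N) (k : ι) (n : ℕ) :
    AntitoneOn (fun τ => extrinsicMoment p W σ k τ n) (Icc (fun _ => 0) fun _ => 1) := by
  intro τ hτ τ' hτ' hle
  have piecewise_le (S : Finset ι) : extrinsicMoment p W σ k (S.piecewise τ' τ) n ≤
      extrinsicMoment p W σ k τ n := by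
    induction S using Finset.induction_on with
    | empty => simp
    | insert l S hl ih =>
      have update_self : Function.update (S.piecewise τ' τ) l (τ l) = S.piecewise τ' τ :=
        Function.update_eq_self_iff.mpr (S.piecewise_eq_of_notMem τ' τ hl).symm
      rw [Finset.piecewise_insert]
      refine le_trans ?_ ih
      conv_rhs => rw [← update_self]
      exact extrinsicMoment_update_le p σ k l n _
        (hW.degraded (τ l) (τ' l) (hτ.1 l) (hle l) (hτ'.2 l))
  simpa using piecewise_le Finset.univ

theorem IsACOrderedFamily.isWeightedSeries {W : ℝ → BMSChannel} (hW : IsACOrderedFamily W)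
    (σ : ι → Fin N) :
    IsWeightedSeries (entropyTerm W) (channelEntropy W) 0 1
      (fun τ : ι → ℝ => condEntropy p (observationLaw W σ τ)) (gexitWeight p W σ) where
  toIsMonotoneSeries := hW.isMonotoneSeries
  hasSum_update_sub k τ s t := by
    have hasSum_sub :=
      (hasSum_condEntropy_update p W σ k τ s).sub (hasSum_condEntropy_update p W σ k τ t)
    rw [sub_sub_sub_cancel_left] at hasSum_sub
    exact hasSum_sub.congr_fun fun n => by rw [entropyTerm, entropyTerm]; ring
  weight_mem := gexitWeight_mem p W σ
  weight_monotoneOn k n _ hτ _ hτ' hle :=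
    sub_le_sub_left (extrinsicMoment_antitoneOn p hW σ k n hτ hτ' hle) 1

end Gexit

section Relabeling

variable {N : ℕ} {ι κ : Type*} [Fintype ι] [Fintype κ]

theorem weightEntropy_comp_equiv {A : Type*} [Fintype A] (e : A ≃ A) (v : A → ℝ) :
    weightEntropy (fun a => v (e a)) = weightEntropy v := by
  rw [weightEntropy, weightEntropy, Equiv.sum_comp e v,
    Equiv.sum_comp e fun a => Real.negMulLog (v a)]

theorem measurePreserving_comp_equiv (W : ℝ → BMSChannel) (e : ι ≃ κ) (τ : κ → ℝ) :
    MeasurePreserving (fun d : κ → SoftBit => d ∘ e) (softLawPi W τ) (softLawPi W (τ ∘ e)) :=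
  (measurePreserving_piCongrLeft (fun k => (W (τ k)).softLaw) e).symm

variable (p : PMF (Fin N → ℤˣ)) {σ : ι → Fin N} {σ' : κ → Fin N} (e : ι ≃ κ)
  (π : Equiv.Perm (Fin N))

theorem jointWeight_relabel (hp : ∀ x, p (x ∘ π) = p x) (h : ∀ k, σ' (e k) = π (σ k))
    (d : κ → SoftBit) (x : Fin N → ℤˣ) :
    jointWeight p σ (d ∘ e) (x ∘ π) = jointWeight p σ' d x := by
  rw [jointWeight, jointWeight, hp, vectorLikelihood, vectorLikelihood, ← Equiv.prod_comp e]
  simp only [h, Function.comp_apply]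

theorem condEntropy_relabel (W : ℝ → BMSChannel) (hp : ∀ x, p (x ∘ π) = p x)
    (h : ∀ k, σ' (e k) = π (σ k)) (τ : κ → ℝ) :
    condEntropy p (observationLaw W σ (τ ∘ e)) = condEntropy p (observationLaw W σ' τ) := by
  rw [condEntropy_observationLaw, condEntropy_observationLaw,
    ← integral_comp_of_measurePreserving (measurePreserving_comp_equiv W e τ)
      (measurable_weightEntropy_jointWeight p σ).aestronglyMeasurable]
  congr 2
  funext d
  rw [← funext (jointWeight_relabel p e π hp h d)]
  exact (weightEntropy_comp_equiv (π.symm.arrowCongr (Equiv.refl ℤˣ)) _).symm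

theorem apply_comp_of_mem_symmetryGroup {p : PMF (Fin N → ℤˣ)} {π : Equiv.Perm (Fin N)}
    (h : π ∈ symmetryGroup p) (x : Fin N → ℤˣ) : p (x ∘ π) = p x := by
  have map_eq : p.map (fun x => x ∘ π) = p := h
  conv_lhs => rw [← map_eq]
  rw [PMF.map_apply, tsum_eq_single x]
  · simp
  · intro y hy
    exact if_neg fun heq => hy (π.surjective.injective_comp_right heq).symm

end Relabeling

section ExtraLook

variable {N : ℕ} (p : PMF (Fin N → ℤˣ)) (i j : Fin N)

theorem jointWeight_extraLook (d : Option (Fin N) → SoftBit) (hd : d none = SoftBit.zero) :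
    jointWeight p (extraLook j) d = jointWeight p id fun l => d (some l) := by
  funext x
  rw [jointWeight, jointWeight, vectorLikelihood, vectorLikelihood, Fintype.prod_option, hd,
    likelihood_zero, one_mul]
  rfl

theorem extrinsicBias_extraLook (n : ℕ) (d : Option (Fin N) → SoftBit)
    (hd : d none = SoftBit.zero) :
    extrinsicBias p (extraLook j) (some i) n d = extrinsicBias p id i n fun l => d (some l) := by
  have update_some : (fun l => Function.update d (some i) SoftBit.zero (some l)) =
      Function.update (fun l => d (some l)) i SoftBit.zero :=
    Function.update_comp_eq_of_injective d (Option.some_injective _) i SoftBit.zero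
  rw [extrinsicBias, extrinsicBias, extrinsicWeight, extrinsicWeight,
    jointWeight_extraLook p j _ (by simpa using hd), update_some]
  rfl

variable (W : ℝ → BMSChannel) (t : ℝ)

theorem gexitWeight_extraLook_le (n : ℕ) :
    gexitWeight p W (extraLook j) (some i) (fun _ => t) n ≤
      gexitWeight p W id i (fun _ => t) n := by
  refine sub_le_sub_left ?_ 1
  calc extrinsicMoment p W id i (fun _ => t) n
      = ∫ d, extrinsicBias p id i n (fun l => d (some l))
          ∂softLawPi W fun _ : Option (Fin N) => t :=
        (integral_comp_of_measurePreserving (measurePreserving_comp_some W fun _ => t)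
          (measurable_extrinsicBias p id i n).aestronglyMeasurable).symm
    _ = ∫ d, extrinsicBias p (extraLook j) (some i) n (Function.update d none SoftBit.zero)
          ∂softLawPi W fun _ => t := by
        congr 1
        funext d
        rw [extrinsicBias_extraLook p i j n _ (Function.update_self _ _ _)]
        simp
    _ ≤ extrinsicMoment p W (extraLook j) (some i) (fun _ => t) n :=
        integral_extrinsicBias_update_zero_le p W (extraLook j) (some i) none n _

theorem integral_weightEntropy_extrinsicWeight_none :
    (∫ d, weightEntropy (extrinsicWeight p (extraLook j) none d) ∂softLawPi W fun _ => t) /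
      Real.log 2 = condEntropy p (observationLaw W id fun _ => t) := by
  rw [condEntropy_observationLaw, ← integral_comp_of_measurePreserving
    (measurePreserving_comp_some W fun _ => t)
    (measurable_weightEntropy_jointWeight p id).aestronglyMeasurable]
  congr 2
  funext d
  rw [extrinsicWeight, jointWeight_extraLook p j _ (Function.update_self _ _ _)]
  simp

theorem condEntropy_sub_condEntropy_extraLook_mem :
    condEntropy p (observationLaw W id fun _ => t) -
      condEntropy p (observationLaw W (extraLook j) fun _ => t) ∈
        Icc 0 (1 - channelEntropy W t) := by
  have hasSum_loss := hasSum_condEntropy_update p W (extraLook j) none (fun _ => t) t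
  rw [Function.update_eq_self_iff.mpr rfl, integral_weightEntropy_extrinsicWeight_none]
    at hasSum_loss
  have term_nonneg n : 0 ≤ bitCoeff n * (W t).softMoment n :=
    mul_nonneg (bitCoeff_nonneg n) ((W t).softMoment_nonneg n)
  have weight_mem := gexitWeight_mem p W (extraLook j) none (fun _ => t)
  exact ⟨hasSum_loss.nonneg fun n => mul_nonneg (term_nonneg n) (weight_mem n).1,
    hasSum_le (fun n => mul_le_of_le_one_right (term_nonneg n) (weight_mem n).2) hasSum_loss
      (hasSum_channelEntropy W t)⟩

theorem extraLook_swap (k : Option (Fin N)) :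
    extraLook j (Equiv.swap none (some j) k) = extraLook j k := by
  rcases k with _ | i
  · simp [extraLook]
  · by_cases hi : i = j
    · subst hi; simp [extraLook]
    · rw [Equiv.swap_apply_of_ne_of_ne (by simp) (by simpa using hi)]

theorem perturbedEntropy_extraLook_none (s : ℝ) :
    perturbedEntropy p W (extraLook j) none t s =
      perturbedEntropy p W (extraLook j) (some j) t s := by
  have update_comp_swap : Function.update (fun _ => t) (some j) s ∘ Equiv.swap none (some j) =
      Function.update (fun _ => t) none s := by
    have h := Function.update_comp_eq_of_injective (fun _ => t)
      (Equiv.swap none (some j)).injective none s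
    rwa [Equiv.swap_apply_left] at h
  rw [perturbedEntropy, perturbedEntropy, ← update_comp_swap]
  exact condEntropy_relabel p (Equiv.swap none (some j)) 1 W (fun _ => rfl) (extraLook_swap j) _

end ExtraLook

section AreaTheorem

variable {N : ℕ} (p : PMF (Fin N → ℤˣ)) {W : ℝ → BMSChannel} (hW : IsACOrderedFamily W)

section Partial

variable {ι : Type*} [Fintype ι] [DecidableEq ι] (σ : ι → Fin N) (k : ι)

include hW

theorem ae_derivWithin_perturbedEntropy : ∀ᵐ t ∂volume.restrict (Icc (0 : ℝ) 1),
    derivWithin (perturbedEntropy p W σ k t) (Icc 0 1) t =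
      diagonalPartial (entropyTerm W) (gexitWeight p W σ) k t :=
  (hW.isWeightedSeries p σ).ae_derivWithin_eq_diagonalPartial k

theorem ae_differentiableWithinAt_perturbedEntropy : ∀ᵐ t ∂volume.restrict (Icc (0 : ℝ) 1),
    DifferentiableWithinAt ℝ (perturbedEntropy p W σ k t) (Icc 0 1) t := by
  filter_upwards [hW.isMonotoneSeries.ae_isTermwiseDifferentiableAt] with t ht
  exact ((hW.isWeightedSeries p σ).hasDerivAt_update ht k).differentiableAt.differentiableWithinAt

theorem ae_uIoc_derivWithin_perturbedEntropy : ∀ᵐ t ∂volume.restrict (uIoc (0 : ℝ) 1),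
    derivWithin (perturbedEntropy p W σ k t) (Icc 0 1) t =
      diagonalPartial (entropyTerm W) (gexitWeight p W σ) k t := by
  rw [uIoc_of_le zero_le_one]
  exact ae_restrict_of_ae_restrict_of_subset Ioc_subset_Icc_self
    (ae_derivWithin_perturbedEntropy p hW σ k)

theorem intervalIntegrable_derivWithin_perturbedEntropy :
    IntervalIntegrable (fun t => derivWithin (perturbedEntropy p W σ k t) (Icc 0 1) t)
      volume 0 1 :=
  ((hW.isWeightedSeries p σ).intervalIntegrable_diagonalPartial k).congr_ae
    ((ae_uIoc_derivWithin_perturbedEntropy p hW σ k).mono fun _ h => h.symm)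

theorem integral_derivWithin_perturbedEntropy :
    ∫ t in (0 : ℝ)..1, derivWithin (perturbedEntropy p W σ k t) (Icc 0 1) t =
      ∫ t in (0 : ℝ)..1, diagonalPartial (entropyTerm W) (gexitWeight p W σ) k t :=
  intervalIntegral.integral_congr_ae_restrict (ae_uIoc_derivWithin_perturbedEntropy p hW σ k)

theorem sum_integral_derivWithin_perturbedEntropy :
    ∑ k, ∫ t in (0 : ℝ)..1, derivWithin (perturbedEntropy p W σ k t) (Icc 0 1) t =
      condEntropy p (observationLaw W σ fun _ => 1) -
        condEntropy p (observationLaw W σ fun _ => 0) := by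
  simp only [integral_derivWithin_perturbedEntropy p hW]
  exact (hW.isWeightedSeries p σ).sum_integral_diagonalPartial

end Partial

include hW

theorem sum_integral_gexit : ∑ i, ∫ t in (0 : ℝ)..1, gexit p W i t =
    condEntropy p (observationLaw W id fun _ => 1) -
      condEntropy p (observationLaw W id fun _ => 0) :=
  sum_integral_derivWithin_perturbedEntropy p hW id

theorem sum_integral_gexitExtra (j : Fin N) :
    (∫ t in (0 : ℝ)..1, gexitExtra p W j j t) + ∑ i, ∫ t in (0 : ℝ)..1, gexitExtra p W i j t =
      condEntropy p (observationLaw W (extraLook j) fun _ => 1) -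
        condEntropy p (observationLaw W (extraLook j) fun _ => 0) := by
  rw [← sum_integral_derivWithin_perturbedEntropy p hW (extraLook j), Fintype.sum_option]
  simp only [funext (perturbedEntropy_extraLook_none p j W _)]
  rfl

theorem integral_gexitExtra_le_integral_gexit (i j : Fin N) :
    ∫ t in (0 : ℝ)..1, gexitExtra p W i j t ≤ ∫ t in (0 : ℝ)..1, gexit p W i t := by
  refine (integral_derivWithin_perturbedEntropy p hW (extraLook j) (some i)).trans_le
    (le_trans ?_ (integral_derivWithin_perturbedEntropy p hW id i).ge)
  exact (hW.isWeightedSeries p (extraLook j)).integral_diagonalPartial_le_integral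
    (hW.isWeightedSeries p id) fun t _ n => gexitWeight_extraLook_le p i j W t n

theorem integral_gexitExtra_le (i j : Fin N) : ∫ t in (0 : ℝ)..1, gexitExtra p W i j t ≤
    channelEntropy W 1 - channelEntropy W 0 :=
  (integral_derivWithin_perturbedEntropy p hW (extraLook j) (some i)).trans_le
    ((hW.isWeightedSeries p (extraLook j)).integral_diagonalPartial_le (some i))

theorem integral_gexit_sub (i j : Fin N) :
    ∫ t in (0 : ℝ)..1, (gexit p W i t - gexitExtra p W i j t) =
      (∫ t in (0 : ℝ)..1, gexit p W i t) - ∫ t in (0 : ℝ)..1, gexitExtra p W i j t :=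
  intervalIntegral.integral_sub (intervalIntegrable_derivWithin_perturbedEntropy p hW id i)
    (intervalIntegrable_derivWithin_perturbedEntropy p hW (extraLook j) (some i))

theorem sum_integral_gexit_sub_le_one (j : Fin N) :
    ∑ i : Fin N with i ≠ j, ∫ t in (0 : ℝ)..1, (gexit p W i t - gexitExtra p W i j t) ≤ 1 := by
  have area := sum_integral_gexit p hW
  have area_extra := sum_integral_gexitExtra p hW j
  have information_zero := (condEntropy_sub_condEntropy_extraLook_mem p j W 0).1
  have information_one := (condEntropy_sub_condEntropy_extraLook_mem p j W 1).2
  have extra_le := integral_gexitExtra_le_integral_gexit p hW j j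
  have extra_le_channel := integral_gexitExtra_le p hW j j
  have channel_nonneg := channelEntropy_nonneg W 0
  simp only [integral_gexit_sub p hW]
  rw [Finset.filter_ne', Finset.sum_erase_eq_sub (Finset.mem_univ j), Finset.sum_sub_distrib]
  linarith

theorem sum_sum_integral_gexit_sub_le :
    ∑ i : Fin N, ∑ j : Fin N with i ≠ j,
      ∫ t in (0 : ℝ)..1, (gexit p W i t - gexitExtra p W i j t) ≤ (N : ℝ) := by
  calc ∑ i : Fin N, ∑ j : Fin N with i ≠ j,
        ∫ t in (0 : ℝ)..1, (gexit p W i t - gexitExtra p W i j t)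
      = ∑ j : Fin N, ∑ i : Fin N with i ≠ j,
          ∫ t in (0 : ℝ)..1, (gexit p W i t - gexitExtra p W i j t) := by
        simp only [Finset.sum_filter]
        exact Finset.sum_comm
    _ ≤ ∑ _j : Fin N, 1 := Finset.sum_le_sum fun j _ => sum_integral_gexit_sub_le_one p hW j
    _ = N := by simp

end AreaTheorem

section Symmetry

variable {N : ℕ} {p : PMF (Fin N → ℤˣ)} (W : ℝ → BMSChannel) {π : Equiv.Perm (Fin N)}

theorem perturbedEntropy_relabel {ι κ : Type*} [Fintype ι] [DecidableEq ι] [Fintype κ]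
    [DecidableEq κ] {σ : ι → Fin N} {σ' : κ → Fin N} (e : ι ≃ κ) (hπ : π ∈ symmetryGroup p)
    (h : ∀ k, σ' (e k) = π (σ k)) (k : ι) (t s : ℝ) :
    perturbedEntropy p W σ k t s = perturbedEntropy p W σ' (e k) t s := by
  rw [perturbedEntropy, perturbedEntropy,
    ← condEntropy_relabel p e π W (apply_comp_of_mem_symmetryGroup hπ) h,
    Function.update_comp_eq_of_injective _ e.injective]
  rfl

theorem gexit_eq_of_mem_symmetryGroup (hπ : π ∈ symmetryGroup p) (i : Fin N) (t : ℝ) :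
    gexit p W i t = gexit p W (π i) t :=
  congrArg (fun f => derivWithin f (Icc 0 1) t)
    (funext fun s =>
    perturbedEntropy_relabel W (σ := id) (σ' := id) π hπ (fun _ => rfl) i t s)

theorem gexitExtra_eq_of_mem_symmetryGroup (hπ : π ∈ symmetryGroup p) (i j : Fin N) (t : ℝ) :
    gexitExtra p W i j t = gexitExtra p W (π i) (π j) t :=
  congrArg (fun f => derivWithin f (Icc 0 1) t) (funext fun s =>
    perturbedEntropy_relabel W (Equiv.optionCongr π) hπ (by rintro (_ | l) <;> rfl) (some i) t s)

theorem HasDoublyTransitiveSymmetry.integral_gexit_sub_le (h : HasDoublyTransitiveSymmetry p)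
    {W : ℝ → BMSChannel} (hW : IsACOrderedFamily W) {i j : Fin N} (hij : i ≠ j) :
    ∫ t in (0 : ℝ)..1, (gexit p W i t - gexitExtra p W i j t) ≤ 1 / ((N : ℝ) - 1) := by
  have sum_le := sum_integral_gexit_sub_le_one p hW j
  have integral_eq (k : Fin N) (hk : k ∈ Finset.univ.erase j) :
      ∫ t in (0 : ℝ)..1, (gexit p W k t - gexitExtra p W k j t) =
        ∫ t in (0 : ℝ)..1, (gexit p W i t - gexitExtra p W i j t) := by
    obtain ⟨π, hπ, rfl, hj⟩ := h k j i j (Finset.ne_of_mem_erase hk) hij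
    refine intervalIntegral.integral_congr fun t _ => ?_
    simp only [gexit_eq_of_mem_symmetryGroup W hπ k, gexitExtra_eq_of_mem_symmetryGroup W hπ k, hj]
  have one_lt : 1 < N := by simpa using Fintype.one_lt_card_iff.mpr ⟨i, j, hij⟩
  have sub_one_pos : (0 : ℝ) < N - 1 := sub_pos.mpr (Nat.one_lt_cast.mpr one_lt)
  rw [Finset.filter_ne', Finset.sum_congr rfl integral_eq, Finset.sum_const,
    Finset.card_erase_of_mem (Finset.mem_univ j), Finset.card_univ, Fintype.card_fin,
    nsmul_eq_mul, Nat.cast_sub one_lt.le, Nat.cast_one] at sum_le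
  rwa [le_div_iff₀' sub_one_pos]

end Symmetry

theorem mainTheorem6_general (W : ℝ → BMSChannel) (hW : IsACOrderedFamily W) (N : ℕ)
    (p : PMF (Fin N → ℤˣ)) :
    (∀ i : Fin N,
      (∀ᵐ t ∂(volume.restrict (Icc (0 : ℝ) 1)),
        DifferentiableWithinAt ℝ (entropyAt p W i t) (Icc 0 1) t) ∧
      IntervalIntegrable (gexit p W i) volume 0 1) ∧
    (∀ i j : Fin N, i ≠ j →
      (∀ᵐ t ∂(volume.restrict (Icc (0 : ℝ) 1)),
        DifferentiableWithinAt ℝ (entropyAtExtra p W i j t) (Icc 0 1) t) ∧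
      IntervalIntegrable (gexitExtra p W i j) volume 0 1) ∧
    (∑ i : Fin N, ∑ j : Fin N with i ≠ j,
      ∫ t in (0 : ℝ)..1, (gexit p W i t - gexitExtra p W i j t)) ≤ (N : ℝ) ∧
    (HasTransitiveSymmetry p →
      ∀ i k : Fin N, ∀ t ∈ Icc (0 : ℝ) 1, gexit p W i t = gexit p W k t) ∧
    (HasDoublyTransitiveSymmetry p →
      (∀ i j k l : Fin N, i ≠ j → k ≠ l → ∀ t ∈ Icc (0 : ℝ) 1,
        gexitExtra p W i j t = gexitExtra p W k l t) ∧
      (∀ i j : Fin N, i ≠ j →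
        ∫ t in (0 : ℝ)..1, (gexit p W i t - gexitExtra p W i j t) ≤ 1 / ((N : ℝ) - 1))) := by
  refine ⟨fun i => ⟨ae_differentiableWithinAt_perturbedEntropy p hW id i,
      intervalIntegrable_derivWithin_perturbedEntropy p hW id i⟩,
    fun i j _ => ⟨ae_differentiableWithinAt_perturbedEntropy p hW (extraLook j) (some i),
      intervalIntegrable_derivWithin_perturbedEntropy p hW (extraLook j) (some i)⟩,
    sum_sum_integral_gexit_sub_le p hW, fun transitive i k t _ => ?_,
    fun doublyTransitive => ⟨fun i j k l hij hkl t _ => ?_,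
      fun i j hij => doublyTransitive.integral_gexit_sub_le hW hij⟩⟩
  · obtain ⟨π, hπ, rfl⟩ := transitive i k
    exact gexit_eq_of_mem_symmetryGroup W hπ i t
  · obtain ⟨π, hπ, rfl, rfl⟩ := doublyTransitive i j k l hij hkl
    exact gexitExtra_eq_of_mem_symmetryGroup W hπ i j t

theorem mainTheorem6 (W : ℝ → BMSChannel) (hW : IsACDegradedFamily W) (N : ℕ)
    (p : PMF (Fin N → ℤˣ)) :
    -- the GEXIT functions exist almost everywhere and are integrable on `[0,1]`
    (∀ i : Fin N,
      (∀ᵐ t ∂(MeasureTheory.volume.restrict (Set.Icc (0 : ℝ) 1)),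
        DifferentiableWithinAt ℝ (entropyAt p W i t) (Set.Icc 0 1) t) ∧
      IntervalIntegrable (gexit p W i) MeasureTheory.volume 0 1) ∧
    (∀ i j : Fin N, i ≠ j →
      (∀ᵐ t ∂(MeasureTheory.volume.restrict (Set.Icc (0 : ℝ) 1)),
        DifferentiableWithinAt ℝ (entropyAtExtra p W i j t) (Set.Icc 0 1) t) ∧
      IntervalIntegrable (gexitExtra p W i j) MeasureTheory.volume 0 1) ∧
    -- the bound for every input distribution
    (∑ i : Fin N, ∑ j : Fin N with i ≠ j,
      ∫ t in (0 : ℝ)..1, (gexit p W i t - gexitExtra p W i j t)) ≤ (N : ℝ) ∧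
    -- transitive symmetry
    (HasTransitiveSymmetry p →
      ∀ i k : Fin N, ∀ t ∈ Set.Icc (0 : ℝ) 1, gexit p W i t = gexit p W k t) ∧
    -- doubly transitive symmetry
    (HasDoublyTransitiveSymmetry p →
      (∀ i j k l : Fin N, i ≠ j → k ≠ l → ∀ t ∈ Set.Icc (0 : ℝ) 1,
        gexitExtra p W i j t = gexitExtra p W k l t) ∧
      (∀ i j : Fin N, i ≠ j →
        ∫ t in (0 : ℝ)..1, (gexit p W i t - gexitExtra p W i j t) ≤ 1 / ((N : ℝ) - 1))) :=
  mainTheorem6_general W ⟨hW.degraded, hW.absolutelyContinuous⟩ N p
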